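/- **Setting.** Let $V:\mathbb R\to\mathbb R$ be an even $C^\infty$ function with $V(0)=0$ such that, for some $a>0$: $V'(x)=0$ exactly for $x\in\{-a,0,a\}$; $V''(a)>0$, $V''(0)<0$, and $V$ attains its minimum at $\pm a$; $V(x)\ge C_4x^4-C_2x^2$ for some $C_4,C_2>0$; $V''(x)\to+\infty$ as $x\to\pm\infty$ and $V''>0$ on $[a,\infty)$. Let $F$ be an even convex real polynomial of degree $2n$, $n\ge1$, such that $F'$ is convex on $[0,\infty)$. Assume that for some integer $q\ge1$ and some $C>0$ one has, for all $x,y\in\mathbb R$, $|V'(x)|\le C(1+x^{2q})$ and $|F'(x)-F'(y)|\le C|x-y|(1+|x|^{2q-2}+|y|^{2q-2})$. Put $\alpha=F''(0)$. For $\epsilon>0$ and $m=(m_1,\dots,m_{2n-1})\in\mathbb R^{2n-1}$ let $$W_m(x)=V(x)+F(x-a)+\sum_{p=1}^{2n-1}\frac{(-1)^p}{p!}(m_p-a^p)F^{(p)}(x),\qquad u_{\epsilon,m}(x)=\frac{e^{-\frac2\epsilon W_m(x)}}{\int_{\mathbb R}e^{-\frac2\epsilon W_m(z)}dz},$$ and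 let $\Phi^{(\epsilon)}:\mathbb R^{2n-1}\to\mathbb R^{2n-1}$ be the moment map $\Phi^{(\epsilon)}(m)_k=\frac{\int_{\mathbb R}x^k e^{-\frac2\epsilon W_m(x)}dx}{\int_{\mathbb R}e^{-\frac2\epsilon W_m(x)}dx}$, $1\le k\le 2n-1$. **Theorem.** Assume $$\sum_{p=0}^{2n-2}\frac{|F^{(p+2)}(a)|}{p!}a^p<\alpha+V''(a),$$ and set, for $1\le k\le 2n-1$, $$\tau_k^0=k a^{k-1}\,\frac{aV'''(a)-(k-1)V''(a)}{4aV''(a)(\alpha+V''(a))},$$ which is the unique solution of the linear system $$\sum_{p=1}^{2n-1}\frac{(-1)^p}{p!}F^{(p+1)}(a)\,\tau_p+\frac{\alpha+V''(a)}{ka^{k-1}}\,\tau_k=\frac{V'''(a)}{4(\alpha+V''(a))}-\frac{k-1}{4a},\qquad 1\le k\le 2n-1.$$ Then for every $\delta>0$ there is $\epsilon_0>0$ such that for every $0<\epsilon\le\epsilon_0$ the map $\Phi^{(\epsilon)}$ has two distinct fixed points $m^+(\epsilon)$ and $m^-(\epsilon)$ satisfying, for all $1\le k\le 2n-1$, $$\left|m_k^\pm(\epsilon)-\big((\pm1)^ka^k-(\pm1)^k\tau_k^0\epsilon\big)\right|\le\delta\,k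 a^{k-1}\,\epsilon,$$ and moreover, for every such $k$ with $\tau_k^0\neq0$, $$\left|m_k^\pm(\epsilon)-\big((\pm1)^ka^k-(\pm1)^k\tau_k^0\epsilon\big)\right|\le\delta\,|\tau_k^0|\,\epsilon.$$ For $m=m^\pm(\epsilon)$ the function $u=u_{\epsilon,m}$ is the density of a probability measure with finite moments of every order, whose moments of orders $1,\dots,2n-1$ are $m_1,\dots,m_{2n-1}$, and which is invariant for the self-stabilizing diffusion, in the sense that $u$ is a stationary solution of its Kolmogorov equation: $\frac\epsilon2u''+\big(u\,(V'+F'*u)\big)'=0$ on $\mathbb R$. Thus the estimates give the first-order asymptotics of the moments of these outlying invariant measures. -/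

import Mathlib

open MeasureTheory Filter Set
open scoped ContDiff

noncomputable section

namespace SelfStab

/-- Standing assumptions on the double-well potential `V`, with wells at `a` and `-a`.
The pair `(q, C)` is the growth exponent and constant shared with the interaction. -/
structure IsDoubleWell (V : ℝ → ℝ) (a : ℝ) (q : ℕ) (C : ℝ) : Prop where
  smooth : ContDiff ℝ ∞ V
  even : ∀ x, V (-x) = V x
  a_pos : 0 < a
  critical : ∀ x, deriv V x = 0 ↔ x = a ∨ x = -a ∨ x = 0
  second_at_well : 0 < iteratedDeriv 2 V a
  second_at_zero : iteratedDeriv 2 V 0 < 0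
  /-- the bottoms of the wells are at `a` and (by evenness) at `-a` -/
  bottom : ∀ x, V a ≤ V x
  quartic : ∃ C₄ > 0, ∃ C₂ > 0, ∀ x, C₄ * x ^ 4 - C₂ * x ^ 2 ≤ V x
  second_atTop : Tendsto (iteratedDeriv 2 V) atTop atTop
  second_atBot : Tendsto (iteratedDeriv 2 V) atBot atTop
  convex_outside : ∀ x, a ≤ x → 0 < iteratedDeriv 2 V x
  growth : ∀ x, |deriv V x| ≤ C * (1 + x ^ (2 * q))
  zero : V 0 = 0

/-- The `j`-th derivative of the polynomial `F` at the point `x`. -/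
def polyDeriv (F : Polynomial ℝ) (j : ℕ) (x : ℝ) : ℝ :=
  (Polynomial.derivative^[j] F).eval x

/-- Standing assumptions on the interaction function, an even convex polynomial. -/
structure IsInteraction (F : Polynomial ℝ) (q : ℕ) (C : ℝ) : Prop where
  even : ∀ x, F.eval (-x) = F.eval x
  convex : ConvexOn ℝ univ (fun x => F.eval x)
  deriv_convex : ConvexOn ℝ (Ici 0) (polyDeriv F 1)
  growth : ∀ x y, |polyDeriv F 1 x - polyDeriv F 1 y|
    ≤ C * |x - y| * (1 + |x| ^ (2 * q - 2) + |y| ^ (2 * q - 2))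

/-- `α = F''(0)`. -/
def alpha (F : Polynomial ℝ) : ℝ := polyDeriv F 2 0

/-- `Z_m(x) = F(x - a) + ∑_{p=1}^{2n-1} (-1)^p / p! (m_p - a^p) F^{(p)}(x)`.
Vectors in `ℝ^{2n-1}` are indexed by `Fin (2n-1)`; the index `i` carries the order `i + 1`. -/
def Z (F : Polynomial ℝ) (a : ℝ) (n : ℕ) (m : Fin (2 * n - 1) → ℝ) (x : ℝ) : ℝ :=
  F.eval (x - a) + ∑ i : Fin (2 * n - 1),
    (-1) ^ ((i : ℕ) + 1) / (((i : ℕ) + 1).factorial : ℝ) * (m i - a ^ ((i : ℕ) + 1))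
      * polyDeriv F ((i : ℕ) + 1) x

/-- `exp(-(2/ε) W_m(x))` with `W_m = V + Z_m`. -/
def weight (V : ℝ → ℝ) (F : Polynomial ℝ) (a : ℝ) (n : ℕ) (ε : ℝ)
    (m : Fin (2 * n - 1) → ℝ) (x : ℝ) : ℝ :=
  Real.exp (-(2 / ε) * (V x + Z F a n m x))

/-- The moment map `Φ^{(ε)}` of `ℝ^{2n-1}`, whose component of order `k` is
`∫ x^k exp(-(2/ε) W_m) dx / ∫ exp(-(2/ε) W_m) dx`. -/
def momentMap (V : ℝ → ℝ) (F : Polynomial ℝ) (a : ℝ) (n : ℕ) (ε : ℝ)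
    (m : Fin (2 * n - 1) → ℝ) : Fin (2 * n - 1) → ℝ := fun i =>
  (∫ x : ℝ, x ^ ((i : ℕ) + 1) * weight V F a n ε m x) / ∫ x : ℝ, weight V F a n ε m x

/-- The density `u_{ε,m}` associated to the vector `m`. -/
def assocDensity (V : ℝ → ℝ) (F : Polynomial ℝ) (a : ℝ) (n : ℕ) (ε : ℝ)
    (m : Fin (2 * n - 1) → ℝ) (x : ℝ) : ℝ :=
  weight V F a n ε m x / ∫ z : ℝ, weight V F a n ε m z

/-- `u` is the density of a probability measure with finite moments of every order which is
invariant for the self-stabilizing diffusion, i.e. a time-independent solution of its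
(nonlinear) Kolmogorov equation: `(ε/2) u'' + (u (V' + F' * u))' = 0`. -/
structure IsStationaryDensity (V : ℝ → ℝ) (F : Polynomial ℝ) (ε : ℝ) (u : ℝ → ℝ) : Prop where
  nonneg : ∀ x, 0 ≤ u x
  moments : ∀ k : ℕ, Integrable (fun x => x ^ k * u x)
  mass : ∫ x, u x = 1
  regular : ContDiff ℝ 2 u
  flux_differentiable :
    Differentiable ℝ (fun x => u x * (deriv V x + ∫ y, polyDeriv F 1 (x - y) * u y))
  stationary : ∀ x, ε / 2 * iteratedDeriv 2 u x
    + deriv (fun x => u x * (deriv V x + ∫ y, polyDeriv F 1 (x - y) * u y)) x = 0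

/-- The linear system for the first order coefficients: for `1 ≤ k ≤ 2n-1`,
`∑_{p=1}^{2n-1} (-1)^p/p! F^{(p+1)}(a) τ_p + (α + V''(a))/(k a^{k-1}) τ_k
  = V'''(a)/(4(α + V''(a))) - (k-1)/(4a)`. -/
def IsCramerSolution (V : ℝ → ℝ) (F : Polynomial ℝ) (a : ℝ) (n : ℕ)
    (τ : Fin (2 * n - 1) → ℝ) : Prop :=
  ∀ k : Fin (2 * n - 1),
    (∑ p : Fin (2 * n - 1), (-1) ^ ((p : ℕ) + 1) / (((p : ℕ) + 1).factorial : ℝ)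
        * polyDeriv F ((p : ℕ) + 2) a * τ p)
      + (alpha F + iteratedDeriv 2 V a) / (((k : ℕ) + 1 : ℝ) * a ^ (k : ℕ)) * τ k
    = iteratedDeriv 3 V a / (4 * (alpha F + iteratedDeriv 2 V a)) - ((k : ℕ) : ℝ) / (4 * a)

/-- `τ_k^0 = k a^{k-1} (a V'''(a) - (k-1) V''(a)) / (4 a V''(a) (α + V''(a)))`, `k = i + 1`. -/
def tau (V : ℝ → ℝ) (F : Polynomial ℝ) (a : ℝ) (n : ℕ) (i : Fin (2 * n - 1)) : ℝ :=
  ((i : ℕ) + 1 : ℝ) * a ^ (i : ℕ)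
    * (a * iteratedDeriv 3 V a - ((i : ℕ) : ℝ) * iteratedDeriv 2 V a)
    / (4 * a * iteratedDeriv 2 V a * (alpha F + iteratedDeriv 2 V a))

/-- `m` is a fixed point of the moment map, and its associated density is the density of an
invariant probability measure whose moments of order `1, …, 2n-1` are the components of `m`. -/
structure IsInvariantFixedPoint (V : ℝ → ℝ) (F : Polynomial ℝ) (a : ℝ) (n : ℕ) (ε : ℝ)
    (m : Fin (2 * n - 1) → ℝ) : Prop where
  fixed : momentMap V F a n ε m = m
  stationary : IsStationaryDensity V F ε (assocDensity V F a n ε m)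
  moment_eq : ∀ i : Fin (2 * n - 1),
    ∫ x, x ^ ((i : ℕ) + 1) * assocDensity V F a n ε m x = m i

end SelfStab

end

noncomputable section

namespace SelfStab

/-! Put ε = r² and m_k = a^k + r² s_k. The moment terms in the exponent -(2/ε) W_m then lose their
factor 1/ε: up to a constant, the weight is exp(-(2/r²) U - 2 ∑ s_i g_i). Here U is V + F(· - a)
minus its value at a; it has a nondegenerate global minimum at a with U''(a) = w = α + V''(a), and
every g_i vanishes at a. A fixed point near (a^k) is a vector s such that x^k has mean a^k + r² s_k,
and such an s is sought near -τ⁰.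

Laplace's method is run through integration by parts. Uniformly for bounded s, the density is
dominated by a Gaussian of width r and has mass at least of order r (`exists_dominated`), so a
function vanishing to order j at a has mean O(r^j). Stein's identity with test functions x - a and 1
gives the means of (x - a)² and x - a up to O(r³), hence the mean of any smooth f of polynomial
growth (`exists_mean_expansion`). Differences in s obey the differenced expansion with error O(‖s' -
s‖ r³) (`exists_mean_sub_expansion`).

After division by r² the fixed-point equation is an O(r) perturbation, in the Lipschitz sense too,
of an affine equation with rank-one linear part, and the linear system for τ⁰ says that -τ⁰ solves
it. In the coordinates s_k / (k a^(k-1)) the linear part has sup-norm Lipschitz constant at most (∑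
|F^(p+2)(a)| a^p / p!) / w, which is below 1 by hypothesis. The contraction principle concludes
(`exists_selfConsistent`).

Evenness of V and F gives the second fixed point by reflection. Invariance holds because F' * u
depends only on the first 2n-1 moments of u: at a fixed point it equals Z_m', so the flux is -(ε/2)
u'. The closed form of τ⁰ rests on the Taylor expansions about a of F''(0) = α and F'''(0) = 0. -/

theorem pow_le_one_add_pow {t : ℝ} (ht : 0 ≤ t) {m n : ℕ} (h : m ≤ n) : t ^ m ≤ 1 + t ^ n := by
  rcases le_total t 1 with h1 | h1
  · have := pow_le_one₀ (n := m) ht h1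
    have := pow_nonneg ht n
    linarith
  · have := pow_le_pow_right₀ h1 h
    linarith

/-- `φ` is continuous, vanishes to order `j` at `a` and has at most polynomial growth. -/
def PolyO (a : ℝ) (j : ℕ) (φ : ℝ → ℝ) : Prop :=
  Continuous φ ∧ ∃ K : ℝ, ∃ M : ℕ, 0 ≤ K ∧ ∀ x, |φ x| ≤ K * (|x - a| ^ j * (1 + |x - a| ^ M))

/-! ### Calculus of vanishing order and polynomial growth. -/

namespace PolyO

variable {a : ℝ} {i j : ℕ} {φ ψ : ℝ → ℝ}

theorem add (h₁ : PolyO a j φ) (h₂ : PolyO a j ψ) : PolyO a j (fun x => φ x + ψ x) := by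
  obtain ⟨c₁, K₁, M₁, hK₁, h₁⟩ := h₁
  obtain ⟨c₂, K₂, M₂, hK₂, h₂⟩ := h₂
  refine ⟨c₁.add c₂, 2 * K₁ + 2 * K₂, M₁ + M₂, by positivity, fun x => ?_⟩
  have e₁ := pow_le_one_add_pow (abs_nonneg (x - a)) (Nat.le_add_right M₁ M₂)
  have e₂ := pow_le_one_add_pow (abs_nonneg (x - a)) (Nat.le_add_left M₂ M₁)
  have p := pow_nonneg (abs_nonneg (x - a)) (M₁ + M₂)
  have pj := pow_nonneg (abs_nonneg (x - a)) j
  calc |φ x + ψ x| ≤ |φ x| + |ψ x| := abs_add_le _ _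
    _ ≤ K₁ * (|x - a| ^ j * (1 + |x - a| ^ M₁)) + K₂ * (|x - a| ^ j * (1 + |x - a| ^ M₂)) :=
      add_le_add (h₁ x) (h₂ x)
    _ ≤ K₁ * (|x - a| ^ j * (2 * (1 + |x - a| ^ (M₁ + M₂))))
        + K₂ * (|x - a| ^ j * (2 * (1 + |x - a| ^ (M₁ + M₂)))) := by
      gcongr <;> linarith
    _ = _ := by ring

theorem mul (h₁ : PolyO a i φ) (h₂ : PolyO a j ψ) : PolyO a (i + j) (fun x => φ x * ψ x) := by
  obtain ⟨c₁, K₁, M₁, hK₁, h₁⟩ := h₁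
  obtain ⟨c₂, K₂, M₂, hK₂, h₂⟩ := h₂
  refine ⟨c₁.mul c₂, 3 * (K₁ * K₂), M₁ + M₂, by positivity, fun x => ?_⟩
  have e₁ := pow_le_one_add_pow (abs_nonneg (x - a)) (Nat.le_add_right M₁ M₂)
  have e₂ := pow_le_one_add_pow (abs_nonneg (x - a)) (Nat.le_add_left M₂ M₁)
  have p := pow_nonneg (abs_nonneg (x - a)) (M₁ + M₂)
  rw [abs_mul]
  calc |φ x| * |ψ x| ≤ (K₁ * (|x - a| ^ i * (1 + |x - a| ^ M₁)))
        * (K₂ * (|x - a| ^ j * (1 + |x - a| ^ M₂))) :=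
      mul_le_mul (h₁ x) (h₂ x) (abs_nonneg _) (by positivity)
    _ = K₁ * K₂ * (|x - a| ^ (i + j) * (1 + |x - a| ^ M₁ + |x - a| ^ M₂ + |x - a| ^ (M₁ + M₂))) := by
      ring
    _ ≤ K₁ * K₂ * (|x - a| ^ (i + j) * (3 * (1 + |x - a| ^ (M₁ + M₂)))) := by
      gcongr; linarith
    _ = _ := by ring

theorem mono (h : PolyO a j φ) (hij : i ≤ j) : PolyO a i φ := by
  obtain ⟨c, K, M, hK, h⟩ := h
  refine ⟨c, 2 * K, j - i + M, by positivity, fun x => (h x).trans ?_⟩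
  have e₁ := pow_le_one_add_pow (abs_nonneg (x - a)) (Nat.le_add_right (j - i) M)
  have p := pow_nonneg (abs_nonneg (x - a)) (j - i + M)
  have : |x - a| ^ j = |x - a| ^ i * |x - a| ^ (j - i) := by rw [← pow_add]; congr 1; omega
  calc K * (|x - a| ^ j * (1 + |x - a| ^ M))
      = K * (|x - a| ^ i * (|x - a| ^ (j - i) + |x - a| ^ (j - i + M))) := by rw [this]; ring
    _ ≤ K * (|x - a| ^ i * (2 * (1 + |x - a| ^ (j - i + M)))) := by gcongr; linarith
    _ = _ := by ring

theorem const (c : ℝ) : PolyO a 0 (fun _ => c) :=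
  ⟨continuous_const, |c|, 0, abs_nonneg c, fun x => by simp; linarith [abs_nonneg c]⟩

theorem const_mul (c : ℝ) (h : PolyO a j φ) : PolyO a j (fun x => c * φ x) := by
  simpa using (const (a := a) c).mul h

theorem id_sub_pow (a : ℝ) (j : ℕ) : PolyO a j (fun x => (x - a) ^ j) :=
  ⟨by fun_prop, 1, 0, zero_le_one, fun x => by
    rw [abs_pow]; have := pow_nonneg (abs_nonneg (x - a)) j; simp; linarith⟩

theorem id_sub (a : ℝ) : PolyO a 1 (fun x => x - a) := by
  simpa using id_sub_pow a 1

theorem neg (h : PolyO a j φ) : PolyO a j (fun x => - φ x) := by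
  simpa using h.const_mul (-1)

theorem sub (h₁ : PolyO a j φ) (h₂ : PolyO a j ψ) : PolyO a j (fun x => φ x - ψ x) := by
  simpa [sub_eq_add_neg] using h₁.add h₂.neg

theorem sum {κ : Type*} (s : Finset κ) {f : κ → ℝ → ℝ} (h : ∀ k ∈ s, PolyO a j (f k)) :
    PolyO a j (fun x => ∑ k ∈ s, f k x) := by
  classical
  induction s using Finset.induction_on with
  | empty => simpa using (const (a := a) 0).mul (id_sub_pow a j)
  | insert k s hk ih =>
    simp only [Finset.sum_insert hk]
    exact (h k (by simp)).add (ih fun l hl => h l (by simp [hl]))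

/-- Beyond distance 1 from a the factor |x - a|^j is at least 1, so the vanishing order only has to
be checked near a. -/
theorem of_local (h₀ : PolyO a 0 φ) {K : ℝ} (h : ∀ x, |x - a| ≤ 1 → |φ x| ≤ K * |x - a| ^ j) :
    PolyO a j φ := by
  obtain ⟨c, K', M, hK', h'⟩ := h₀
  refine ⟨c, |K| + K', M, by positivity, fun x => ?_⟩
  have pj := pow_nonneg (abs_nonneg (x - a)) j
  have pM := pow_nonneg (abs_nonneg (x - a)) M
  rcases le_total |x - a| 1 with hx | hx
  · calc |φ x| ≤ K * |x - a| ^ j := h x hx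
      _ ≤ |K| * |x - a| ^ j := by gcongr; exact le_abs_self K
      _ = |K| * (|x - a| ^ j * 1) := by ring
      _ ≤ (|K| + K') * (|x - a| ^ j * (1 + |x - a| ^ M)) := by gcongr <;> linarith
  · have h1 : 1 ≤ |x - a| ^ j := one_le_pow₀ hx
    calc |φ x| ≤ K' * (|x - a| ^ 0 * (1 + |x - a| ^ M)) := h' x
      _ = K' * (1 * (1 + |x - a| ^ M)) := by ring
      _ ≤ (|K| + K') * (|x - a| ^ j * (1 + |x - a| ^ M)) := by
        gcongr
        linarith [abs_nonneg K]

theorem id_pow (a : ℝ) (k : ℕ) : PolyO a 0 (fun x => x ^ k) := by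
  have h1 : PolyO a 0 (fun x => x) := by
    simpa using ((id_sub a).mono (Nat.zero_le 1)).add (const a)
  induction k with
  | zero => simpa using const (a := a) 1
  | succ k ih => simpa [pow_succ] using ih.mul h1

theorem eval (a : ℝ) (P : Polynomial ℝ) : PolyO a 0 (fun x => P.eval x) := by
  simp only [Polynomial.eval_eq_sum_range]
  exact sum _ fun k _ => (id_pow a k).const_mul _

end PolyO

/-! ### Taylor remainders. -/

theorem abs_le_of_abs_deriv_le {a : ℝ} {f f' : ℝ → ℝ} {K : ℝ} {j : ℕ}
    (hf : ∀ x, HasDerivAt f (f' x) x) (h0 : f a = 0) (hK : 0 ≤ K)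
    (h : ∀ x, |x - a| ≤ 1 → |f' x| ≤ K * |x - a| ^ j) (x : ℝ) (hx : |x - a| ≤ 1) :
    |f x| ≤ K * |x - a| ^ (j + 1) := by
  have key := Convex.norm_image_sub_le_of_norm_hasDerivWithin_le (f := f) (f' := f')
    (s := Icc (a - |x - a|) (a + |x - a|)) (x := a) (y := x) (C := K * |x - a| ^ j)
    (fun z _ => (hf z).hasDerivWithinAt)
    (fun z hz => by
      have hz' : |z - a| ≤ |x - a| := by rw [abs_le]; constructor <;> linarith [hz.1, hz.2]
      refine (h z (hz'.trans hx)).trans ?_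
      gcongr)
    (convex_Icc _ _) ⟨by linarith [abs_nonneg (x - a)], by linarith [abs_nonneg (x - a)]⟩
    ⟨by linarith [neg_abs_le (x - a)], by linarith [le_abs_self (x - a)]⟩
  rw [h0, sub_zero, Real.norm_eq_abs, Real.norm_eq_abs] at key
  rw [pow_succ, ← mul_assoc]; exact key

/-- The derivative of the remainder of order j + 1 of f is the remainder of order j of f', and the
mean value inequality gains one power. -/
theorem taylor_local_bound (a : ℝ) (j : ℕ) : ∀ f : ℝ → ℝ, ContDiff ℝ ∞ f →
    ∃ K : ℝ, 0 ≤ K ∧ ∀ x, |x - a| ≤ 1 →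
      |f x - ∑ i ∈ Finset.range j, iteratedDeriv i f a / (i.factorial : ℝ) * (x - a) ^ i|
        ≤ K * |x - a| ^ j := by
  induction j with
  | zero =>
    intro f hf
    obtain ⟨K, hK⟩ := (isCompact_Icc (a := a - 1) (b := a + 1)).exists_bound_of_continuousOn
      hf.continuous.continuousOn
    refine ⟨|K|, abs_nonneg K, fun x hx => ?_⟩
    rw [abs_le] at hx
    simpa using (hK x ⟨by linarith [hx.1], by linarith [hx.2]⟩).trans (le_abs_self K)
  | succ j ih =>
    intro f hf
    have hf' : ContDiff ℝ ∞ (deriv f) := (contDiff_infty_iff_deriv.1 hf).2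
    obtain ⟨K, hK, h⟩ := ih (deriv f) hf'
    refine ⟨K, hK, abs_le_of_abs_deriv_le (f' := fun x => deriv f x - ∑ i ∈ Finset.range j,
      iteratedDeriv i (deriv f) a / (i.factorial : ℝ) * (x - a) ^ i) (fun x => ?_) ?_ hK h⟩
    · refine ((hf.differentiable (by simp)) x).hasDerivAt.sub ?_
      simp only [Finset.sum_range_succ' _ j]
      have : ∀ i ∈ Finset.range j, HasDerivAt
          (fun x => iteratedDeriv (i + 1) f a / ((i + 1).factorial : ℝ) * (x - a) ^ (i + 1))
          (iteratedDeriv i (deriv f) a / (i.factorial : ℝ) * (x - a) ^ i) x := by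
        intro i _
        have h1 := (((hasDerivAt_id x).sub_const a).fun_pow (i + 1)).const_mul
          (iteratedDeriv (i + 1) f a / ((i + 1).factorial : ℝ))
        refine h1.congr_deriv ?_
        rw [iteratedDeriv_succ', Nat.factorial_succ]
        have : (i.factorial : ℝ) ≠ 0 := by positivity
        push_cast
        simp
        field_simp
      simpa using HasDerivAt.fun_sum this
    · simp [Finset.sum_range_succ']

theorem PolyO.taylor {a : ℝ} {f : ℝ → ℝ} (hf : ContDiff ℝ ∞ f) (h : PolyO a 0 f) (j : ℕ) :
    PolyO a j (fun x =>
      f x - ∑ i ∈ Finset.range j, iteratedDeriv i f a / (i.factorial : ℝ) * (x - a) ^ i) := by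
  obtain ⟨K, -, hK⟩ := taylor_local_bound a j f hf
  exact PolyO.of_local (h.sub (PolyO.sum _ fun i _ =>
    ((PolyO.id_sub_pow a i).mono (Nat.zero_le i)).const_mul _)) hK

theorem PolyO.taylor_one {a : ℝ} {f : ℝ → ℝ} (hf : ContDiff ℝ ∞ f) (h : PolyO a 0 f) :
    PolyO a 1 (fun x => f x - f a) := by
  simpa using PolyO.taylor hf h 1

theorem PolyO.taylor_two {a : ℝ} {f : ℝ → ℝ} (hf : ContDiff ℝ ∞ f) (h : PolyO a 0 f) :
    PolyO a 2 (fun x => f x - (f a + deriv f a * (x - a))) := by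
  simpa [Finset.sum_range_succ] using PolyO.taylor hf h 2

theorem PolyO.taylor_three {a : ℝ} {f : ℝ → ℝ} (hf : ContDiff ℝ ∞ f) (h : PolyO a 0 f) :
    PolyO a 3 (fun x =>
      f x - (f a + deriv f a * (x - a) + iteratedDeriv 2 f a / 2 * (x - a) ^ 2)) := by
  simpa [Finset.sum_range_succ] using PolyO.taylor hf h 3

theorem PolyO.abs {a : ℝ} {j : ℕ} {φ : ℝ → ℝ} (h : PolyO a j φ) : PolyO a j (fun x => |φ x|) := by
  obtain ⟨c, K, M, hK, h⟩ := h
  exact ⟨c.abs, K, M, hK, fun x => by simpa using h x⟩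

/-! ### Gaussian moments under scaling. -/

section Gaussian

variable {c : ℝ}

theorem integrable_abs_pow_mul_exp (hc : 0 < c) (j : ℕ) :
    Integrable (fun z : ℝ => |z| ^ j * Real.exp (-c * z ^ 2)) := by
  have h := (integrable_rpow_mul_exp_neg_mul_sq hc (s := (j : ℝ))
    (by have := Nat.cast_nonneg (α := ℝ) j; linarith)).norm
  refine h.congr (Eventually.of_forall fun z => ?_)
  simp [Real.rpow_natCast]

theorem integrable_scaled_abs_pow_mul_exp (hc : 0 < c) (j : ℕ) (a : ℝ) {r : ℝ} (hr : 0 < r) :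
    Integrable (fun x : ℝ => |x - a| ^ j * Real.exp (-c * ((x - a) / r) ^ 2)) ∧
    ∫ x : ℝ, |x - a| ^ j * Real.exp (-c * ((x - a) / r) ^ 2)
      = r ^ (j + 1) * ∫ z : ℝ, |z| ^ j * Real.exp (-c * z ^ 2) := by
  have e : (fun x : ℝ => |x - a| ^ j * Real.exp (-c * ((x - a) / r) ^ 2)) =
      fun x => r ^ j * (fun z : ℝ => |z| ^ j * Real.exp (-c * z ^ 2)) ((x - a) / r) := by
    funext x
    simp only [abs_div, abs_of_pos hr, div_pow]
    field_simp
  constructor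
  · rw [e]
    exact (((integrable_abs_pow_mul_exp hc j).comp_div hr.ne').comp_sub_right a).const_mul _
  · rw [e, integral_const_mul,
      integral_sub_right_eq_self (fun y => (fun z : ℝ => |z| ^ j * Real.exp (-c * z ^ 2)) (y / r)) a,
      Measure.integral_comp_div (fun z : ℝ => |z| ^ j * Real.exp (-c * z ^ 2)), abs_of_pos hr, smul_eq_mul, pow_succ, mul_assoc]

/-- Substituting x = a + r z yields r^j from the weight and one more r from dx; r ≤ 1 absorbs the
higher power j + M. -/
theorem exists_gaussian_bound (hc : 0 < c) (j M : ℕ) (a : ℝ) :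
    ∃ K : ℝ, 0 ≤ K ∧ ∀ r : ℝ, 0 < r → r ≤ 1 →
      Integrable (fun x : ℝ => |x - a| ^ j * (1 + |x - a| ^ M) *
        Real.exp (-c * ((x - a) / r) ^ 2)) ∧
      ∫ x : ℝ, |x - a| ^ j * (1 + |x - a| ^ M) * Real.exp (-c * ((x - a) / r) ^ 2)
        ≤ K * r ^ (j + 1) := by
  have pos : ∀ k : ℕ, 0 ≤ ∫ z : ℝ, |z| ^ k * Real.exp (-c * z ^ 2) := fun k =>
    integral_nonneg fun z => by positivity
  refine ⟨(∫ z : ℝ, |z| ^ j * Real.exp (-c * z ^ 2)) +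
    ∫ z : ℝ, |z| ^ (j + M) * Real.exp (-c * z ^ 2), add_nonneg (pos _) (pos _),
    fun r hr hr1 => ?_⟩
  have e : (fun x : ℝ => |x - a| ^ j * (1 + |x - a| ^ M) * Real.exp (-c * ((x - a) / r) ^ 2)) =
      fun x => |x - a| ^ j * Real.exp (-c * ((x - a) / r) ^ 2) +
        |x - a| ^ (j + M) * Real.exp (-c * ((x - a) / r) ^ 2) := by
    funext x; ring
  obtain ⟨i₁, e₁⟩ := integrable_scaled_abs_pow_mul_exp hc j a hr
  obtain ⟨i₂, e₂⟩ := integrable_scaled_abs_pow_mul_exp hc (j + M) a hr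
  rw [e]
  refine ⟨i₁.add i₂, ?_⟩
  rw [integral_add i₁ i₂, e₁, e₂, add_mul, mul_comm (r ^ (j + 1)), mul_comm (r ^ (j + M + 1))]
  have : r ^ (j + M + 1) ≤ r ^ (j + 1) := pow_le_pow_of_le_one hr.le hr1 (by omega)
  have := pos (j + M)
  gcongr

end Gaussian

/-! ### Tilted Laplace densities: uniform bounds and integration by parts. -/

theorem abs_exp_sub_exp_le (u v : ℝ) :
    |Real.exp u - Real.exp v| ≤ |u - v| * (Real.exp u + Real.exp v) := by
  have key : ∀ u v : ℝ, Real.exp u - Real.exp v ≤ |u - v| * (Real.exp u + Real.exp v) := by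
    intro u v
    have h1 := Real.add_one_le_exp (v - u)
    have h2 : Real.exp v = Real.exp u * Real.exp (v - u) := by rw [← Real.exp_add]; ring_nf
    have h3 := Real.exp_pos u
    have h4 := Real.exp_pos v
    have h5 : Real.exp u - Real.exp v ≤ Real.exp u * (u - v) := by rw [h2]; nlinarith
    have h6 : Real.exp u * (u - v) ≤ Real.exp u * |u - v| := by gcongr; exact le_abs_self _
    nlinarith [abs_nonneg (u - v)]
  rw [abs_le]
  constructor
  · have := key v u
    rw [abs_sub_comm, add_comm] at this
    linarith
  · exact key u v

/-- A phase `U` with a nondegenerate global minimum at `a`, together with perturbations `g i`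
that are dominated by the growth of `U`. -/
structure LaplaceFamily (ι : Type*) where
  (a w v c : ℝ)
  n : ℕ
  (U U' : ℝ → ℝ)
  (g g' : ι → ℝ → ℝ)
  γ : ι → ℝ
  w_pos : 0 < w
  c_pos : 0 < c
  hasDeriv_U : ∀ x, HasDerivAt U (U' x) x
  lower : ∀ x, c * ((x - a) ^ 2 + (x - a) ^ (2 * n)) ≤ U x
  upper : PolyO a 2 U
  U'_expansion : PolyO a 3 (fun x => U' x - (w * (x - a) + v * (x - a) ^ 2))
  hasDeriv_g : ∀ i x, HasDerivAt (g i) (g' i x) x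
  g_polyO : ∀ i, PolyO a 1 (g i)
  g_bound : ∀ i, ∃ K, 0 ≤ K ∧ ∀ x, |g i x| ≤ K * (|x - a| + (x - a) ^ (2 * n))
  g'_expansion : ∀ i, PolyO a 1 (fun x => g' i x - γ i)

namespace LaplaceFamily

variable {ι : Type*}

theorem polyO_U' {L : LaplaceFamily ι} : PolyO L.a 0 L.U' := by
  have := (L.U'_expansion.mono (Nat.zero_le 3)).add
    ((((PolyO.id_sub L.a).mono (Nat.zero_le 1)).const_mul L.w).add
      (((PolyO.id_sub_pow L.a 2).mono (Nat.zero_le 2)).const_mul L.v))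
  simpa using this

theorem polyO_g' {L : LaplaceFamily ι} (i : ι) : PolyO L.a 0 (L.g' i) := by
  simpa using ((L.g'_expansion i).mono (Nat.zero_le 1)).add (PolyO.const (a := L.a) (L.γ i))

variable [Fintype ι] (L : LaplaceFamily ι)

/-- The unnormalised density with temperature `r ^ 2` and perturbation `∑ s i g i`. -/
def density (r : ℝ) (s : ι → ℝ) (x : ℝ) : ℝ :=
  Real.exp (-(2 / r ^ 2) * L.U x - 2 * ∑ i, s i * L.g i x)

/-- The expectation of `φ` under the normalised density. -/
def mean (r : ℝ) (s : ι → ℝ) (φ : ℝ → ℝ) : ℝ :=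
  (∫ x, φ x * L.density r s x) / ∫ x, L.density r s x

/-- The density is dominated by a Gaussian of width `r` and has mass of order at least `r`. -/
structure Dominated (B r : ℝ) (s : ι → ℝ) : Prop where
  pos : 0 < r
  le_one : r ≤ 1
  norm_le : ‖s‖ ≤ B
  bound : ∀ x, L.density r s x ≤ B * Real.exp (-L.c * ((x - L.a) / r) ^ 2)
  mass : r ≤ B * ∫ x, L.density r s x

theorem density_pos (r : ℝ) (s : ι → ℝ) (x : ℝ) : 0 < L.density r s x := Real.exp_pos _

theorem continuous_density (r : ℝ) (s : ι → ℝ) : Continuous (L.density r s) := by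
  have := L.upper.1
  have := fun i => (L.g_polyO i).1
  unfold density
  fun_prop

section Dominated

variable {L} {B r : ℝ} {s : ι → ℝ}

theorem Dominated.nonneg (h : L.Dominated B r s) : 0 ≤ B := (norm_nonneg s).trans h.norm_le

theorem Dominated.mass_pos (h : L.Dominated B r s) : 0 < ∫ x, L.density r s x := by
  by_contra hn
  have := mul_nonpos_of_nonneg_of_nonpos h.nonneg (not_lt.1 hn)
  linarith [h.pos, h.mass]

variable (L) in
theorem exists_integral_bound (B : ℝ) {j : ℕ} {φ : ℝ → ℝ} (hφ : PolyO L.a j φ) :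
    ∃ K, 0 ≤ K ∧ ∀ r s, L.Dominated B r s →
      Integrable (fun x => φ x * L.density r s x) ∧
      ∫ x, |φ x| * L.density r s x ≤ K * r ^ (j + 1) := by
  obtain ⟨hc, K, M, hK, hφ⟩ := hφ
  obtain ⟨K', hK', hG⟩ := exists_gaussian_bound L.c_pos j M L.a
  refine ⟨|B| * K * K', by positivity, fun r s h => ?_⟩
  obtain ⟨hi, hI⟩ := hG r h.pos h.le_one
  have hi' := hi.const_mul (B * K)
  have hb : ∀ x, |φ x| * L.density r s x ≤ B * K * (|x - L.a| ^ j * (1 + |x - L.a| ^ M) *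
      Real.exp (-L.c * ((x - L.a) / r) ^ 2)) := fun x => by
    calc |φ x| * L.density r s x ≤ (K * (|x - L.a| ^ j * (1 + |x - L.a| ^ M))) *
          (B * Real.exp (-L.c * ((x - L.a) / r) ^ 2)) :=
        mul_le_mul (hφ x) (h.bound x) (L.density_pos r s x).le (by positivity)
      _ = _ := by ring
  have hint : Integrable (fun x => φ x * L.density r s x) :=
    hi'.mono' (hc.mul (L.continuous_density r s)).aestronglyMeasurable
      (Eventually.of_forall fun x => by
        rw [Real.norm_eq_abs, abs_mul, abs_of_pos (L.density_pos r s x)]; exact hb x)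
  refine ⟨hint, ?_⟩
  calc ∫ x, |φ x| * L.density r s x ≤ ∫ x, B * K * (|x - L.a| ^ j * (1 + |x - L.a| ^ M) *
      Real.exp (-L.c * ((x - L.a) / r) ^ 2)) :=
      integral_mono_of_nonneg (Eventually.of_forall fun x =>
        mul_nonneg (abs_nonneg _) (L.density_pos r s x).le) hi' (Eventually.of_forall hb)
    _ ≤ B * K * (K' * r ^ (j + 1)) := by
      rw [integral_const_mul]
      have := h.nonneg
      gcongr
    _ = |B| * K * K' * r ^ (j + 1) := by rw [abs_of_nonneg h.nonneg]; ring

theorem Dominated.integrable (h : L.Dominated B r s) {j : ℕ} {φ : ℝ → ℝ} (hφ : PolyO L.a j φ) :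
    Integrable (fun x => φ x * L.density r s x) := by
  obtain ⟨K, -, hK⟩ := L.exists_integral_bound B hφ
  exact (hK r s h).1

theorem Dominated.mean_add (h : L.Dominated B r s) {i j : ℕ} {φ ψ : ℝ → ℝ}
    (hφ : PolyO L.a i φ) (hψ : PolyO L.a j ψ) :
    L.mean r s (fun x => φ x + ψ x) = L.mean r s φ + L.mean r s ψ := by
  simp only [mean, add_mul]
  rw [integral_add (h.integrable hφ) (h.integrable hψ), add_div]

theorem mean_const_mul (c : ℝ) (φ : ℝ → ℝ) :
    L.mean r s (fun x => c * φ x) = c * L.mean r s φ := by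
  simp only [mean, mul_assoc]
  rw [integral_const_mul, mul_div_assoc]

theorem Dominated.mean_const (h : L.Dominated B r s) (c : ℝ) : L.mean r s (fun _ => c) = c := by
  simp only [mean]
  rw [integral_const_mul, mul_div_assoc, div_self h.mass_pos.ne', mul_one]

variable (L) in
-- The mass is at least r / B, so normalising removes exactly one power of r.
theorem exists_mean_bound (B : ℝ) {j : ℕ} {φ : ℝ → ℝ} (hφ : PolyO L.a j φ) :
    ∃ K, 0 ≤ K ∧ ∀ r s, L.Dominated B r s → |L.mean r s φ| ≤ K * r ^ j := by
  obtain ⟨K, hK, hb⟩ := L.exists_integral_bound B hφ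
  refine ⟨K * |B|, by positivity, fun r s h => ?_⟩
  obtain ⟨-, hI⟩ := hb r s h
  rw [mean, abs_div, abs_of_pos h.mass_pos, div_le_iff₀ h.mass_pos]
  calc |∫ x, φ x * L.density r s x| ≤ ∫ x, |φ x * L.density r s x| := abs_integral_le_integral_abs
    _ = ∫ x, |φ x| * L.density r s x := by
      congr 1; funext x; rw [abs_mul, abs_of_pos (L.density_pos r s x)]
    _ ≤ K * r ^ (j + 1) := hI
    _ = K * r ^ j * r := by ring
    _ ≤ K * r ^ j * (B * ∫ x, L.density r s x) := by
      have := h.mass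
      have := h.pos
      gcongr
    _ = _ := by rw [abs_of_nonneg h.nonneg]; ring

theorem abs_density_sub_le (r : ℝ) (s s' : ι → ℝ) (x : ℝ) :
    |L.density r s' x - L.density r s x| ≤
      ‖s' - s‖ * (2 * (∑ i, |L.g i x|) * (L.density r s' x + L.density r s x)) := by
  refine (abs_exp_sub_exp_le _ _).trans ?_
  rw [← mul_assoc]
  refine mul_le_mul_of_nonneg_right ?_ (by positivity)
  have : (-(2 / r ^ 2) * L.U x - 2 * ∑ i, s' i * L.g i x) -
      (-(2 / r ^ 2) * L.U x - 2 * ∑ i, s i * L.g i x) = -2 * ∑ i, (s' - s) i * L.g i x := by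
    simp only [Pi.sub_apply, sub_mul, Finset.sum_sub_distrib]; ring
  rw [this, abs_mul, abs_neg, abs_two]
  calc 2 * |∑ i, (s' - s) i * L.g i x| ≤ 2 * ∑ i, ‖s' - s‖ * |L.g i x| := by
        gcongr
        refine (Finset.abs_sum_le_sum_abs _ _).trans (Finset.sum_le_sum fun i _ => ?_)
        rw [abs_mul]
        gcongr
        exact norm_le_pi_norm (s' - s) i
    _ = _ := by rw [← Finset.mul_sum]; ring

variable (L) in
-- Changing s brings down a combination of the g_i, each vanishing to first order at a; this gains a
-- factor ‖s' - s‖ and an extra power of r.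
theorem exists_integral_sub_bound (B : ℝ) {j : ℕ} {φ : ℝ → ℝ} (hφ : PolyO L.a j φ) :
    ∃ K, 0 ≤ K ∧ ∀ r s s', L.Dominated B r s → L.Dominated B r s' →
      |(∫ x, φ x * L.density r s' x) - ∫ x, φ x * L.density r s x|
        ≤ K * ‖s' - s‖ * r ^ (j + 2) := by
  have hψ : PolyO L.a (j + 1) (fun x => φ x * ∑ i, |L.g i x|) :=
    hφ.mul (PolyO.sum _ fun i _ => (L.g_polyO i).abs)
  obtain ⟨K, hK, hb⟩ := L.exists_integral_bound B hψ
  refine ⟨4 * K, by positivity, fun r s s' h h' => ?_⟩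
  obtain ⟨-, hI⟩ := hb r s h
  obtain ⟨-, hI'⟩ := hb r s' h'
  have i₁ := h.integrable hψ.abs
  have i₂ := h'.integrable hψ.abs
  have hG : ∀ x, |(∑ i, |L.g i x|)| = ∑ i, |L.g i x| := fun x =>
    abs_of_nonneg (Finset.sum_nonneg fun i _ => abs_nonneg _)
  rw [← integral_sub (h'.integrable hφ) (h.integrable hφ)]
  calc |∫ x, (φ x * L.density r s' x - φ x * L.density r s x)|
      ≤ ∫ x, |φ x * L.density r s' x - φ x * L.density r s x| := abs_integral_le_integral_abs
    _ ≤ ∫ x, 2 * ‖s' - s‖ * (|φ x * (∑ i, |L.g i x|)| * L.density r s' x +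
          |φ x * (∑ i, |L.g i x|)| * L.density r s x) := by
        refine integral_mono_of_nonneg (Eventually.of_forall fun x => abs_nonneg _)
          ((i₂.add i₁).const_mul _) (Eventually.of_forall fun x => ?_)
        simp only [← mul_sub, abs_mul, hG]
        calc |φ x| * |L.density r s' x - L.density r s x| ≤ |φ x| * (‖s' - s‖ *
              (2 * (∑ i, |L.g i x|) * (L.density r s' x + L.density r s x))) := by
              gcongr; exact abs_density_sub_le r s s' x
          _ = _ := by ring
    _ ≤ 2 * ‖s' - s‖ * (K * r ^ (j + 1 + 1) + K * r ^ (j + 1 + 1)) := by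
        rw [integral_const_mul, integral_add i₂ i₁]
        gcongr
    _ = _ := by ring

variable (L) in
theorem exists_mean_sub_bound (B : ℝ) {j : ℕ} {φ : ℝ → ℝ} (hφ : PolyO L.a j φ) :
    ∃ K, 0 ≤ K ∧ ∀ r s s', L.Dominated B r s → L.Dominated B r s' →
      |L.mean r s' φ - L.mean r s φ| ≤ K * ‖s' - s‖ * r ^ (j + 1) := by
  obtain ⟨K₁, hK₁, h₁⟩ := L.exists_integral_sub_bound B hφ
  obtain ⟨K₂, hK₂, h₂⟩ := L.exists_integral_sub_bound B (PolyO.const (a := L.a) 1)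
  obtain ⟨K₃, hK₃, h₃⟩ := L.exists_mean_bound B hφ
  refine ⟨(K₁ + K₃ * K₂) * |B|, by positivity, fun r s s' h h' => ?_⟩
  have b₁ := h₁ r s s' h h'
  have b₂ := h₂ r s s' h h'
  have b₃ := h₃ r s h
  have hr := h.pos
  have hB := h.nonneg
  simp only [one_mul] at b₂
  -- Difference of quotients N'/D' - N/D = ((N' - N) - (N/D)(D' - D)) / D', which leaves a mean and
  -- two integral differences, all already estimated.
  have e : L.mean r s' φ - L.mean r s φ =
      (((∫ x, φ x * L.density r s' x) - ∫ x, φ x * L.density r s x) -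
        L.mean r s φ * ((∫ x, L.density r s' x) - ∫ x, L.density r s x)) /
        ∫ x, L.density r s' x := by
    have := h.mass_pos.ne'
    have := h'.mass_pos.ne'
    simp only [mean]
    field_simp
    ring
  rw [e, abs_div, abs_of_pos h'.mass_pos, div_le_iff₀ h'.mass_pos]
  calc _ ≤ |(∫ x, φ x * L.density r s' x) - ∫ x, φ x * L.density r s x| +
        |L.mean r s φ * ((∫ x, L.density r s' x) - ∫ x, L.density r s x)| := abs_sub _ _
    _ ≤ K₁ * ‖s' - s‖ * r ^ (j + 2) + (K₃ * r ^ j) * (K₂ * ‖s' - s‖ * r ^ (0 + 2)) := by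
        rw [abs_mul]; gcongr
    _ = (K₁ + K₃ * K₂) * ‖s' - s‖ * r ^ (j + 1) * r := by ring
    _ ≤ (K₁ + K₃ * K₂) * ‖s' - s‖ * r ^ (j + 1) * (B * ∫ x, L.density r s' x) := by
        have := h'.mass
        gcongr
    _ = _ := by rw [abs_of_nonneg hB]; ring

theorem Dominated.mean_sum (h : L.Dominated B r s) {f : ι → ℝ → ℝ}
    (hf : ∀ i, PolyO L.a 0 (f i)) :
    L.mean r s (fun x => ∑ i, s i * f i x) = ∑ i, s i * L.mean r s (f i) := by
  simp only [mean, Finset.sum_mul]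
  rw [integral_finsetSum _ fun i _ => ?_, Finset.sum_div]
  · refine Finset.sum_congr rfl fun i _ => ?_
    simp only [mul_assoc]
    rw [integral_const_mul, mul_div_assoc]
  · simpa [mul_assoc] using (h.integrable (hf i)).const_mul (s i)

/-- Integration by parts against the density. -/
theorem Dominated.stein (h : L.Dominated B r s) {ψ ψ' : ℝ → ℝ}
    (hd : ∀ x, HasDerivAt ψ (ψ' x) x) (hψ : PolyO L.a 0 ψ) (hψ' : PolyO L.a 0 ψ') :
    L.mean r s (fun x => ψ x * L.U' x) + r ^ 2 * ∑ i, s i * L.mean r s (fun x => ψ x * L.g' i x)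
      = r ^ 2 / 2 * L.mean r s ψ' := by
  have hr := h.pos.ne'
  have hA := hψ.mul (polyO_U' (L := L))
  have hg : ∀ i, PolyO L.a 0 (fun x => ψ x * L.g' i x) := fun i => hψ.mul (polyO_g' i)
  have hS : PolyO L.a 0 (fun x => ∑ i, s i * (ψ x * L.g' i x)) :=
    PolyO.sum _ fun i _ => (hg i).const_mul _
  have hT : PolyO L.a 0 (fun x => ψ' x + ((-(2 / r ^ 2)) * (ψ x * L.U' x) +
      (-2) * ∑ i, s i * (ψ x * L.g' i x))) :=
    hψ'.add ((hA.const_mul _).add (hS.const_mul _))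
  have hρ : ∀ x, HasDerivAt (fun x => ψ x * L.density r s x)
      ((ψ' x + ((-(2 / r ^ 2)) * (ψ x * L.U' x) +
      (-2) * ∑ i, s i * (ψ x * L.g' i x))) * L.density r s x) x := by
    intro x
    have h1 : HasDerivAt (fun x => ∑ i, s i * L.g i x) (∑ i, s i * L.g' i x) x :=
      HasDerivAt.fun_sum fun i _ => (L.hasDeriv_g i x).const_mul (s i)
    have h2 := (((L.hasDeriv_U x).const_mul (-(2 / r ^ 2))).sub (h1.const_mul 2)).exp
    refine ((hd x).mul h2).congr_deriv ?_
    have : ∑ i, s i * (ψ x * L.g' i x) = ψ x * ∑ i, s i * L.g' i x := by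
      rw [Finset.mul_sum]; exact Finset.sum_congr rfl fun i _ => by ring
    rw [this]
    simp only [density, Pi.sub_apply]
    ring
  -- The derivative of ψ times the density integrates to zero; polynomial growth provides both
  -- integrability conditions.
  have key := integral_eq_zero_of_hasDerivAt_of_integrable hρ (h.integrable hT) (h.integrable hψ)
  have key' : L.mean r s (fun x => ψ' x + ((-(2 / r ^ 2)) * (ψ x * L.U' x) +
      (-2) * ∑ i, s i * (ψ x * L.g' i x))) = 0 := by rw [mean, key, zero_div]
  rw [h.mean_add hψ' ((hA.const_mul _).add (hS.const_mul _)),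
    h.mean_add (hA.const_mul _) (hS.const_mul _), mean_const_mul, mean_const_mul,
    h.mean_sum hg] at key'
  field_simp at key'
  linarith

end Dominated

end LaplaceFamily

/-! ### Moment asymptotics as the temperature tends to zero. -/

namespace LaplaceFamily

variable {ι : Type*} [Fintype ι] (L : LaplaceFamily ι)

theorem abs_sum_mul_le {B : ℝ} {s x : ι → ℝ} {t : ℝ} (hB : 0 ≤ B) (hs : ‖s‖ ≤ B)
    (hx : ∀ i, |x i| ≤ t) : |∑ i, s i * x i| ≤ Fintype.card ι * (B * t) := by
  refine (Finset.abs_sum_le_sum_abs _ _).trans ?_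
  rw [← nsmul_eq_mul]
  refine Finset.sum_le_card_nsmul _ _ _ fun i _ => ?_
  rw [abs_mul]
  exact mul_le_mul ((norm_le_pi_norm s i).trans hs) (hx i) (abs_nonneg _) hB

theorem exists_forall_le {p : ι → ℝ → Prop} (hp : ∀ i, ∃ K, 0 ≤ K ∧ p i K)
    (hmono : ∀ i K K', K ≤ K' → p i K → p i K') : ∃ K, 0 ≤ K ∧ ∀ i, p i K := by
  choose K hK hp using hp
  refine ⟨∑ i, K i, Finset.sum_nonneg fun i _ => hK i, fun i => hmono i _ _ ?_ (hp i)⟩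
  exact Finset.single_le_sum (fun i _ => hK i) (Finset.mem_univ i)

/-- The g_i grow no faster than |x - a| + (x - a)^(2n), while U / r² dominates a large multiple of
(x - a)² + (x - a)^(2n). For small r half of the phase absorbs the tilt and the other half leaves a
Gaussian. -/
theorem exists_dominated (R : ℝ) :
    ∃ B, ∀ᶠ r in nhdsWithin 0 (Ioi 0), ∀ s, ‖s‖ ≤ R → L.Dominated B r s := by
  obtain ⟨K, hK, hg⟩ := exists_forall_le
    (p := fun i K => ∀ x, |L.g i x| ≤ K * (|x - L.a| + (x - L.a) ^ (2 * L.n))) L.g_bound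
    (fun i K K' h hx x => (hx x).trans (by
      have : 0 ≤ (x - L.a) ^ (2 * L.n) := by rw [pow_mul]; positivity
      gcongr))
  obtain ⟨-, Ku, M, hKu, hU⟩ := L.upper
  set b : ℝ := 2 * (Fintype.card ι * (|R| * K)) with hb
  have hb0 : 0 ≤ b := by positivity
  have hsum : ∀ s : ι → ℝ, ‖s‖ ≤ R → ∀ x,
      |2 * ∑ i, s i * L.g i x| ≤ b * (|x - L.a| + (x - L.a) ^ (2 * L.n)) := by
    intro s hs x
    have := abs_sum_mul_le (abs_nonneg R) (hs.trans (le_abs_self R)) (fun i => hg i x)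
    rw [abs_mul, abs_two, hb]
    linarith
  set B : ℝ := |R| + Real.exp b + Real.exp (4 * Ku + 2 * b) with hB
  refine ⟨B, ?_⟩
  -- This threshold ensures b r² ≤ c, so that the tilt constant b is at most c / r², half of the
  -- coefficient 2c / r² available from the phase.
  have hsmall : (0 : ℝ) < min 1 (L.c / (b + 1)) := lt_min one_pos (div_pos L.c_pos (by linarith))
  filter_upwards [Ioc_mem_nhdsGT hsmall] with r hr s hs
  have hr0 : 0 < r := hr.1
  have hr1 : r ≤ 1 := hr.2.trans (min_le_left _ _)
  have hr2 : b * r ^ 2 ≤ L.c := by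
    have h1 : r * (b + 1) ≤ L.c := by
      have := hr.2.trans (min_le_right _ _)
      rwa [le_div_iff₀ (by linarith)] at this
    have h2 : r ^ 2 ≤ r := by nlinarith
    nlinarith
  have hbound : ∀ x, L.density r s x ≤ Real.exp b * Real.exp (-L.c * ((x - L.a) / r) ^ 2) := by
    intro x
    rw [← Real.exp_add]
    apply Real.exp_le_exp.2
    have h1 := (abs_le.1 (hsum s hs x)).1
    have hn : 0 ≤ (x - L.a) ^ (2 * L.n) := by rw [pow_mul]; positivity
    have h2 : |x - L.a| ≤ 1 + (x - L.a) ^ 2 := by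
      rw [← sq_abs]; nlinarith [abs_nonneg (x - L.a), sq_nonneg (|x - L.a| - 1)]
    have h3 : b ≤ L.c / r ^ 2 := by rwa [le_div_iff₀ (by positivity)]
    have h4 : 2 / r ^ 2 * (L.c * ((x - L.a) ^ 2 + (x - L.a) ^ (2 * L.n))) ≤ 2 / r ^ 2 * L.U x := by
      have := L.lower x
      gcongr
    have h5 : b * ((x - L.a) ^ 2 + (x - L.a) ^ (2 * L.n)) ≤
        L.c / r ^ 2 * ((x - L.a) ^ 2 + (x - L.a) ^ (2 * L.n)) := by gcongr
    have h6 : 0 ≤ L.c / r ^ 2 * (x - L.a) ^ (2 * L.n) :=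
      mul_nonneg (div_nonneg L.c_pos.le (by positivity)) hn
    have h7 : b * |x - L.a| ≤ b * (1 + (x - L.a) ^ 2) := by gcongr
    have h8 : -L.c * ((x - L.a) / r) ^ 2 = -(L.c / r ^ 2 * (x - L.a) ^ 2) := by
      rw [div_pow]; ring
    have h9 : 2 / r ^ 2 * (L.c * ((x - L.a) ^ 2 + (x - L.a) ^ (2 * L.n))) =
      2 * (L.c / r ^ 2 * ((x - L.a) ^ 2 + (x - L.a) ^ (2 * L.n))) := by ring
    rw [h8]
    nlinarith
  have hexp := Real.exp_pos b
  have hexp' := Real.exp_pos (4 * Ku + 2 * b)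
  refine ⟨hr0, hr1, by rw [hB]; linarith [le_abs_self R], fun x => (hbound x).trans ?_, ?_⟩
  · gcongr
    rw [hB]; linarith [abs_nonneg R]
  · have hint : Integrable (L.density r s) := by
      obtain ⟨hG, -⟩ := integrable_scaled_abs_pow_mul_exp L.c_pos 0 L.a hr0
      refine (hG.const_mul (Real.exp b)).mono' (L.continuous_density r s).aestronglyMeasurable
        (Eventually.of_forall fun x => ?_)
      rw [Real.norm_eq_abs, abs_of_pos (L.density_pos r s x)]
      simpa using hbound x
    -- Within distance r of a, quadratic vanishing gives (2/r²) U ≤ 4 Ku and the tilt is at most 2b.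
    -- The interval has length 2r, whence a mass of order r.
    have hlow : ∀ x ∈ Icc (L.a - r) (L.a + r),
        Real.exp (-(4 * Ku + 2 * b)) ≤ L.density r s x := by
      intro x hx
      apply Real.exp_le_exp.2
      have hx1 : |x - L.a| ≤ r := by rw [abs_le]; constructor <;> linarith [hx.1, hx.2]
      have h1 := (abs_le.1 (hsum s hs x)).2
      have h2 : (x - L.a) ^ (2 * L.n) ≤ 1 := by
        rw [← (even_two_mul L.n).pow_abs]
        exact pow_le_one₀ (abs_nonneg _) (hx1.trans hr1)
      have h3 : |x - L.a| ^ M ≤ 1 := pow_le_one₀ (abs_nonneg _) (hx1.trans hr1)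
      have h4 : L.U x ≤ Ku * (r ^ 2 * (1 + 1)) := by
        refine (le_abs_self _).trans ((hU x).trans ?_)
        gcongr
      have h5 : 2 / r ^ 2 * L.U x ≤ 2 / r ^ 2 * (Ku * (r ^ 2 * (1 + 1))) := by gcongr
      have h6 : 2 / r ^ 2 * (Ku * (r ^ 2 * (1 + 1))) = 4 * Ku := by field_simp; ring
      have h7 : b * (|x - L.a| + (x - L.a) ^ (2 * L.n)) ≤ b * (1 + 1) := by
        gcongr; exact hx1.trans hr1
      linarith
    have h1 : 2 * r * Real.exp (-(4 * Ku + 2 * b)) ≤ ∫ x, L.density r s x := by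
      calc 2 * r * Real.exp (-(4 * Ku + 2 * b))
          = ∫ x in Icc (L.a - r) (L.a + r), Real.exp (-(4 * Ku + 2 * b)) := by
            rw [setIntegral_const, Real.volume_real_Icc_of_le (by linarith), smul_eq_mul]; ring
        _ ≤ ∫ x in Icc (L.a - r) (L.a + r), L.density r s x :=
            setIntegral_mono_on (integrableOn_const (by simp)) hint.integrableOn measurableSet_Icc hlow
        _ ≤ ∫ x, L.density r s x :=
            setIntegral_le_integral hint (Eventually.of_forall fun x => (L.density_pos r s x).le)
    have h2 : Real.exp (4 * Ku + 2 * b) * Real.exp (-(4 * Ku + 2 * b)) = 1 := by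
      rw [← Real.exp_add]; simp
    have h3 : 0 ≤ ∫ x, L.density r s x := integral_nonneg fun x => (L.density_pos r s x).le
    calc r ≤ Real.exp (4 * Ku + 2 * b) * (2 * r * Real.exp (-(4 * Ku + 2 * b))) := by
          linear_combination (exp := 1) hr0.le + 2 * r * (-h2)
      _ ≤ Real.exp (4 * Ku + 2 * b) * ∫ x, L.density r s x := by gcongr
      _ ≤ _ := by
        gcongr
        rw [hB]; linarith [abs_nonneg R]

/-- Stein's identity with test function x - a reads w ⟨(x - a)²⟩ + O(r³) = r²/2, since both the
nonlinear part of U' and the tilt contribute only at order r³. -/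
theorem exists_second_moment_bound (B : ℝ) : ∃ K, 0 ≤ K ∧ ∀ r s, L.Dominated B r s →
    |L.mean r s (fun x => (x - L.a) ^ 2) - r ^ 2 / (2 * L.w)| ≤ K * r ^ 3 := by
  have hQ : PolyO L.a 2 (fun x => L.U' x - L.w * (x - L.a)) := by
    have := (L.U'_expansion.mono (by norm_num : 2 ≤ 3)).add ((PolyO.id_sub_pow L.a 2).const_mul L.v)
    refine cast (congrArg (PolyO L.a 2) (funext fun x => ?_)) this
    ring
  have hyQ : PolyO L.a 3 (fun x => (x - L.a) * (L.U' x - L.w * (x - L.a))) := by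
    simpa using (PolyO.id_sub L.a).mul hQ
  have hy0 := (PolyO.id_sub L.a).mono (Nat.zero_le 1)
  have hyg : ∀ i, PolyO L.a 1 (fun x => (x - L.a) * L.g' i x) := fun i => by
    simpa using (PolyO.id_sub L.a).mul (polyO_g' i)
  obtain ⟨K₁, hK₁, h₁⟩ := L.exists_mean_bound B hyQ
  obtain ⟨K₂, hK₂, h₂⟩ := exists_forall_le
    (p := fun i K => ∀ r s, L.Dominated B r s →
      |L.mean r s (fun x => (x - L.a) * L.g' i x)| ≤ K * r ^ 1)
    (fun i => L.exists_mean_bound B (hyg i))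
    (fun i K K' h hx r s hd => (hx r s hd).trans (by have := hd.pos; gcongr))
  refine ⟨(K₁ + Fintype.card ι * (|B| * K₂)) / L.w, div_nonneg (by positivity) L.w_pos.le,
    fun r s h => ?_⟩
  have hs := h.stein (ψ := fun x => x - L.a) (ψ' := fun _ => 1)
    (fun x => (hasDerivAt_id x).sub_const L.a) hy0 (PolyO.const 1)
  rw [h.mean_const] at hs
  have e : (fun x => (x - L.a) * L.U' x) =
      fun x => L.w * (x - L.a) ^ 2 + (x - L.a) * (L.U' x - L.w * (x - L.a)) := by
    funext x; ring
  rw [e, h.mean_add ((PolyO.id_sub_pow L.a 2).const_mul L.w) hyQ, mean_const_mul] at hs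
  have b₁ := h₁ r s h
  have b₂ := abs_sum_mul_le h.nonneg h.norm_le (fun i => h₂ i r s h)
  have hr := h.pos
  have hw := L.w_pos
  have hid : L.mean r s (fun x => (x - L.a) ^ 2) - r ^ 2 / (2 * L.w) =
      -(L.mean r s (fun x => (x - L.a) * (L.U' x - L.w * (x - L.a))) +
        r ^ 2 * ∑ i, s i * L.mean r s (fun x => (x - L.a) * L.g' i x)) / L.w := by
    field_simp
    linarith
  rw [hid, abs_div, abs_neg, abs_of_pos hw, div_mul_eq_mul_div]
  gcongr
  calc _ ≤ K₁ * r ^ 3 + r ^ 2 * (Fintype.card ι * (B * (K₂ * r ^ 1))) := by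
        refine (abs_add_le _ _).trans (add_le_add b₁ ?_)
        rw [abs_mul, abs_of_pos (by positivity : 0 < r ^ 2)]
        gcongr
    _ = _ := by rw [abs_of_nonneg h.nonneg]; ring

/-- Stein's identity for the constant test function. -/
theorem Dominated.mean_U' {L : LaplaceFamily ι} {B r : ℝ} {s : ι → ℝ} (h : L.Dominated B r s) :
    L.mean r s L.U' + r ^ 2 * (∑ i, s i * L.γ i +
      ∑ i, s i * L.mean r s (fun x => L.g' i x - L.γ i)) = 0 := by
  have hs := h.stein (ψ := fun _ => 1) (ψ' := fun _ => 0) (fun x => hasDerivAt_const x 1)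
    (PolyO.const 1) (PolyO.const 0)
  rw [h.mean_const] at hs
  simp only [one_mul, mul_zero] at hs
  rw [← Finset.sum_add_distrib]
  convert hs using 4 with i
  rw [← mul_add]
  congr 1
  have e : L.g' i = fun x => L.γ i + (L.g' i x - L.γ i) := by funext x; ring
  conv_rhs => rw [show (fun x => L.g' i x) = fun x => L.γ i + (L.g' i x - L.γ i) from e]
  rw [h.mean_add (PolyO.const (L.γ i)) (L.g'_expansion i), h.mean_const]

/-- With the constant test function, w ⟨x - a⟩ + v ⟨(x - a)²⟩ + r² ∑ s_i γ_i = O(r³); inserting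
r²/(2w) for the second moment gives the coefficient v/(2w²). -/
theorem exists_first_moment_bound (B : ℝ) : ∃ K, 0 ≤ K ∧ ∀ r s, L.Dominated B r s →
    |L.mean r s (fun x => x - L.a) +
      r ^ 2 * ((∑ i, s i * L.γ i) / L.w + L.v / (2 * L.w ^ 2))| ≤ K * r ^ 3 := by
  obtain ⟨K₁, hK₁, h₁⟩ := L.exists_second_moment_bound B
  obtain ⟨K₂, hK₂, h₂⟩ := L.exists_mean_bound B L.U'_expansion
  obtain ⟨K₃, hK₃, h₃⟩ := exists_forall_le
    (p := fun i K => ∀ r s, L.Dominated B r s →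
      |L.mean r s (fun x => L.g' i x - L.γ i)| ≤ K * r ^ 1)
    (fun i => L.exists_mean_bound B (L.g'_expansion i))
    (fun i K K' h hx r s hd => (hx r s hd).trans (by have := hd.pos; gcongr))
  refine ⟨(|L.v| * K₁ + K₂ + Fintype.card ι * (|B| * K₃)) / L.w,
    div_nonneg (by positivity) L.w_pos.le, fun r s h => ?_⟩
  have hs := h.mean_U'
  have e : L.U' = fun x => (L.w * (x - L.a) + L.v * (x - L.a) ^ 2) +
      (L.U' x - (L.w * (x - L.a) + L.v * (x - L.a) ^ 2)) := by
    funext x; ring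
  have i₁ := ((PolyO.id_sub L.a).mono (Nat.zero_le 1)).const_mul L.w
  have i₂ := ((PolyO.id_sub_pow L.a 2).mono (Nat.zero_le 2)).const_mul L.v
  have hU : L.mean r s L.U' = L.w * L.mean r s (fun x => x - L.a) +
      L.v * L.mean r s (fun x => (x - L.a) ^ 2) +
      L.mean r s (fun x => L.U' x - (L.w * (x - L.a) + L.v * (x - L.a) ^ 2)) := by
    conv_lhs => rw [e]
    rw [h.mean_add (i₁.add i₂) L.U'_expansion, h.mean_add i₁ i₂, mean_const_mul, mean_const_mul]
  rw [hU] at hs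
  have b₁ := h₁ r s h
  have b₂ := h₂ r s h
  have b₃ := abs_sum_mul_le h.nonneg h.norm_le (fun i => h₃ i r s h)
  have hr := h.pos
  have hw := L.w_pos
  have hid : L.mean r s (fun x => x - L.a) +
      r ^ 2 * ((∑ i, s i * L.γ i) / L.w + L.v / (2 * L.w ^ 2)) =
      -(L.v * (L.mean r s (fun x => (x - L.a) ^ 2) - r ^ 2 / (2 * L.w)) +
        L.mean r s (fun x => L.U' x - (L.w * (x - L.a) + L.v * (x - L.a) ^ 2)) +
        r ^ 2 * ∑ i, s i * L.mean r s (fun x => L.g' i x - L.γ i)) / L.w := by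
    generalize L.mean r s (fun x => L.U' x - (L.w * (x - L.a) + L.v * (x - L.a) ^ 2)) = m₃ at hs ⊢
    field_simp
    linear_combination 2 * L.w * hs
  rw [hid, abs_div, abs_neg, abs_of_pos hw, div_mul_eq_mul_div]
  gcongr
  calc _ ≤ |L.v| * (K₁ * r ^ 3) + K₂ * r ^ 3 +
        r ^ 2 * (Fintype.card ι * (B * (K₃ * r ^ 1))) := by
        refine (abs_add_three _ _ _).trans (add_le_add_three ?_ b₂ ?_)
        · rw [abs_mul]; gcongr
        · rw [abs_mul, abs_of_pos (by positivity : 0 < r ^ 2)]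
          gcongr
    _ = _ := by rw [abs_of_nonneg h.nonneg]; ring

/-- Differencing in s already gains one power of r, so only the linear part of U' is needed here,
and the v-term is absorbed in the error. -/
theorem exists_first_moment_sub_bound (B : ℝ) : ∃ K, 0 ≤ K ∧ ∀ r s s',
    L.Dominated B r s → L.Dominated B r s' →
    |L.mean r s' (fun x => x - L.a) - L.mean r s (fun x => x - L.a) +
      r ^ 2 * ((∑ i, (s' i - s i) * L.γ i) / L.w)| ≤ K * ‖s' - s‖ * r ^ 3 := by
  have hQ : PolyO L.a 2 (fun x => L.U' x - L.w * (x - L.a)) := by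
    have := (L.U'_expansion.mono (by norm_num : 2 ≤ 3)).add ((PolyO.id_sub_pow L.a 2).const_mul L.v)
    refine cast (congrArg (PolyO L.a 2) (funext fun x => ?_)) this
    ring
  obtain ⟨K₁, hK₁, h₁⟩ := L.exists_mean_sub_bound B hQ
  obtain ⟨K₂, hK₂, h₂⟩ := exists_forall_le
    (p := fun i K => ∀ r s s', L.Dominated B r s → L.Dominated B r s' →
      |L.mean r s' (fun x => L.g' i x - L.γ i) - L.mean r s (fun x => L.g' i x - L.γ i)|
        ≤ K * ‖s' - s‖ * r ^ (1 + 1))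
    (fun i => L.exists_mean_sub_bound B (L.g'_expansion i))
    (fun i K K' h hx r s s' hd hd' => (hx r s s' hd hd').trans (by have := hd.pos; gcongr))
  obtain ⟨K₃, hK₃, h₃⟩ := exists_forall_le
    (p := fun i K => ∀ r s, L.Dominated B r s →
      |L.mean r s (fun x => L.g' i x - L.γ i)| ≤ K * r ^ 1)
    (fun i => L.exists_mean_bound B (L.g'_expansion i))
    (fun i K K' h hx r s hd => (hx r s hd).trans (by have := hd.pos; gcongr))
  refine ⟨(K₁ + Fintype.card ι * K₃ + Fintype.card ι * (|B| * K₂)) / L.w,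
    div_nonneg (by positivity) L.w_pos.le, fun r s s' h h' => ?_⟩
  have hU : ∀ s, L.Dominated B r s → L.mean r s L.U' = L.w * L.mean r s (fun x => x - L.a) +
      L.mean r s (fun x => L.U' x - L.w * (x - L.a)) := by
    intro s h
    have e : L.U' = fun x => L.w * (x - L.a) + (L.U' x - L.w * (x - L.a)) := by
      funext x; ring
    conv_lhs => rw [e]
    rw [h.mean_add ((PolyO.id_sub L.a).const_mul L.w) hQ, mean_const_mul]
  have hs := h.mean_U'
  have hs' := h'.mean_U'
  rw [hU s h] at hs
  rw [hU s' h'] at hs'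
  have b₁ := h₁ r s s' h h'
  have b₂ := abs_sum_mul_le h.nonneg h.norm_le (fun i => h₂ i r s s' h h')
  have b₃ := abs_sum_mul_le (norm_nonneg (s' - s)) le_rfl (fun i => h₃ i r s' h')
  have hr := h.pos
  have hw := L.w_pos
  -- Product rule for differences: one part carries s' - s against a small mean, the other carries s
  -- against a small difference of means.
  have hsplit : ∑ i, s' i * L.mean r s' (fun x => L.g' i x - L.γ i) -
      ∑ i, s i * L.mean r s (fun x => L.g' i x - L.γ i) =
      ∑ i, (s' - s) i * L.mean r s' (fun x => L.g' i x - L.γ i) +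
      ∑ i, s i * (L.mean r s' (fun x => L.g' i x - L.γ i) -
        L.mean r s (fun x => L.g' i x - L.γ i)) := by
    rw [← Finset.sum_add_distrib, ← Finset.sum_sub_distrib]
    exact Finset.sum_congr rfl fun i _ => by simp only [Pi.sub_apply]; ring
  have hγ : ∑ i, (s' i - s i) * L.γ i = ∑ i, s' i * L.γ i - ∑ i, s i * L.γ i := by
    rw [← Finset.sum_sub_distrib]
    exact Finset.sum_congr rfl fun i _ => by ring
  have hid : L.mean r s' (fun x => x - L.a) - L.mean r s (fun x => x - L.a) +
      r ^ 2 * ((∑ i, (s' i - s i) * L.γ i) / L.w) =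
      -((L.mean r s' (fun x => L.U' x - L.w * (x - L.a)) -
          L.mean r s (fun x => L.U' x - L.w * (x - L.a))) +
        r ^ 2 * (∑ i, (s' - s) i * L.mean r s' (fun x => L.g' i x - L.γ i)) +
        r ^ 2 * ∑ i, s i * (L.mean r s' (fun x => L.g' i x - L.γ i) -
        L.mean r s (fun x => L.g' i x - L.γ i))) / L.w := by
    rw [add_assoc, ← mul_add, ← hsplit, hγ]
    field_simp
    linarith
  rw [hid, abs_div, abs_neg, abs_of_pos hw, div_mul_eq_mul_div, div_mul_eq_mul_div]
  gcongr
  calc _ ≤ K₁ * ‖s' - s‖ * r ^ (2 + 1) + r ^ 2 * (Fintype.card ι * (‖s' - s‖ * (K₃ * r ^ 1))) +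
        r ^ 2 * (Fintype.card ι * (B * (K₂ * ‖s' - s‖ * r ^ (1 + 1)))) := by
        refine (abs_add_three _ _ _).trans (add_le_add_three b₁ ?_ ?_) <;>
        · rw [abs_mul, abs_of_pos (by positivity : 0 < r ^ 2)]
          gcongr
    _ ≤ K₁ * ‖s' - s‖ * r ^ 3 + r ^ 2 * (Fintype.card ι * (‖s' - s‖ * (K₃ * r ^ 1))) +
        r ^ 2 * (Fintype.card ι * (B * (K₂ * ‖s' - s‖ * r ^ 1))) := by
        have : r ^ (1 + 1) ≤ r ^ 1 := pow_le_pow_of_le_one hr.le h.le_one (by norm_num)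
        have := h.nonneg
        gcongr
    _ = _ := by rw [abs_of_nonneg h.nonneg]; ring

section Observable

variable {f : ℝ → ℝ}

/-- Second-order Taylor expansion of f at a, with the first two centred moments inserted; the
remainder vanishes to order 3 and costs O(r³). -/
theorem exists_mean_expansion (B : ℝ) (hf : ContDiff ℝ ∞ f) (h0 : PolyO L.a 0 f) :
    ∃ K, 0 ≤ K ∧ ∀ r s, L.Dominated B r s →
      |L.mean r s f - (f L.a + r ^ 2 *
        (-deriv f L.a * ((∑ i, s i * L.γ i) / L.w + L.v / (2 * L.w ^ 2)) +
          iteratedDeriv 2 f L.a / (4 * L.w)))| ≤ K * r ^ 3 := by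
  obtain ⟨K₁, hK₁, h₁⟩ := L.exists_first_moment_bound B
  obtain ⟨K₂, hK₂, h₂⟩ := L.exists_second_moment_bound B
  have hR := PolyO.taylor_three hf h0
  obtain ⟨K₃, hK₃, h₃⟩ := L.exists_mean_bound B hR
  refine ⟨|deriv f L.a| * K₁ + |iteratedDeriv 2 f L.a / 2| * K₂ + K₃, by positivity,
    fun r s h => ?_⟩
  have i₁ := ((PolyO.id_sub L.a).mono (Nat.zero_le 1)).const_mul (deriv f L.a)
  have i₂ := ((PolyO.id_sub_pow L.a 2).mono (Nat.zero_le 2)).const_mul (iteratedDeriv 2 f L.a / 2)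
  have i₀ := PolyO.const (a := L.a) (f L.a)
  have e : L.mean r s f = f L.a + deriv f L.a * L.mean r s (fun x => x - L.a) +
      iteratedDeriv 2 f L.a / 2 * L.mean r s (fun x => (x - L.a) ^ 2) +
      L.mean r s (fun x => f x - (f L.a + deriv f L.a * (x - L.a) +
        iteratedDeriv 2 f L.a / 2 * (x - L.a) ^ 2)) := by
    have e' : f = fun x => (f L.a + deriv f L.a * (x - L.a) +
        iteratedDeriv 2 f L.a / 2 * (x - L.a) ^ 2) + (f x - (f L.a + deriv f L.a * (x - L.a) +
        iteratedDeriv 2 f L.a / 2 * (x - L.a) ^ 2)) := by funext x; ring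
    conv_lhs => rw [e']
    rw [h.mean_add ((i₀.add i₁).add i₂) hR, h.mean_add (i₀.add i₁) i₂, h.mean_add i₀ i₁,
      h.mean_const, mean_const_mul, mean_const_mul]
  have b₁ := h₁ r s h
  have b₂ := h₂ r s h
  have b₃ := h₃ r s h
  have hw := L.w_pos
  have hid : L.mean r s f - (f L.a + r ^ 2 *
        (-deriv f L.a * ((∑ i, s i * L.γ i) / L.w + L.v / (2 * L.w ^ 2)) +
          iteratedDeriv 2 f L.a / (4 * L.w))) =
      deriv f L.a * (L.mean r s (fun x => x - L.a) +
        r ^ 2 * ((∑ i, s i * L.γ i) / L.w + L.v / (2 * L.w ^ 2))) +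
      iteratedDeriv 2 f L.a / 2 *
        (L.mean r s (fun x => (x - L.a) ^ 2) - r ^ 2 / (2 * L.w)) +
      L.mean r s (fun x => f x - (f L.a + deriv f L.a * (x - L.a) +
        iteratedDeriv 2 f L.a / 2 * (x - L.a) ^ 2)) := by
    rw [e]; field_simp; ring
  rw [hid]
  calc _ ≤ |deriv f L.a| * (K₁ * r ^ 3) + |iteratedDeriv 2 f L.a / 2| * (K₂ * r ^ 3) +
        K₃ * r ^ 3 := by
        refine (abs_add_three _ _ _).trans (add_le_add_three ?_ ?_ b₃) <;>
        · rw [abs_mul]; gcongr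
    _ = _ := by ring

theorem exists_mean_sub_expansion (B : ℝ) (hf : ContDiff ℝ ∞ f) (h0 : PolyO L.a 0 f) :
    ∃ K, 0 ≤ K ∧ ∀ r s s', L.Dominated B r s → L.Dominated B r s' →
      |L.mean r s' f - L.mean r s f +
        r ^ 2 * (deriv f L.a * ((∑ i, (s' i - s i) * L.γ i) / L.w))| ≤ K * ‖s' - s‖ * r ^ 3 := by
  obtain ⟨K₁, hK₁, h₁⟩ := L.exists_first_moment_sub_bound B
  have hR := PolyO.taylor_two hf h0
  obtain ⟨K₂, hK₂, h₂⟩ := L.exists_mean_sub_bound B hR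
  refine ⟨|deriv f L.a| * K₁ + K₂, by positivity, fun r s s' h h' => ?_⟩
  have e : ∀ s, L.Dominated B r s → L.mean r s f =
      f L.a + deriv f L.a * L.mean r s (fun x => x - L.a) +
      L.mean r s (fun x => f x - (f L.a + deriv f L.a * (x - L.a))) := by
    intro s h
    have i₁ := ((PolyO.id_sub L.a).mono (Nat.zero_le 1)).const_mul (deriv f L.a)
    have i₀ := PolyO.const (a := L.a) (f L.a)
    have e' : f = fun x => (f L.a + deriv f L.a * (x - L.a)) +
        (f x - (f L.a + deriv f L.a * (x - L.a))) := by funext x; ring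
    conv_lhs => rw [e']
    rw [h.mean_add (i₀.add i₁) hR, h.mean_add i₀ i₁, h.mean_const, mean_const_mul]
  have b₁ := h₁ r s s' h h'
  have b₂ := h₂ r s s' h h'
  have hid : L.mean r s' f - L.mean r s f +
        r ^ 2 * (deriv f L.a * ((∑ i, (s' i - s i) * L.γ i) / L.w)) =
      deriv f L.a * (L.mean r s' (fun x => x - L.a) - L.mean r s (fun x => x - L.a) +
      r ^ 2 * ((∑ i, (s' i - s i) * L.γ i) / L.w)) +
      (L.mean r s' (fun x => f x - (f L.a + deriv f L.a * (x - L.a))) -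
      L.mean r s (fun x => f x - (f L.a + deriv f L.a * (x - L.a)))) := by
    rw [e s h, e s' h']; ring
  rw [hid]
  calc _ ≤ |deriv f L.a| * (K₁ * ‖s' - s‖ * r ^ 3) + K₂ * ‖s' - s‖ * r ^ (2 + 1) := by
        refine (abs_add_le _ _).trans (add_le_add ?_ b₂)
        rw [abs_mul]; gcongr
    _ = _ := by ring

end Observable

end LaplaceFamily

/-! ### The contraction argument. -/

theorem eventually_const_mul_le {K η : ℝ} (hK : 0 ≤ K) (hη : 0 < η) :
    ∀ᶠ r in nhdsWithin (0 : ℝ) (Ioi 0), K * r ≤ η := by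
  have : (0 : ℝ) < η / (K + 1) := by positivity
  filter_upwards [Ioc_mem_nhdsGT this] with r hr
  have := hr.2
  rw [le_div_iff₀ (by linarith)] at this
  nlinarith [hr.1]

theorem exists_fixedPoint_of_contraction {E : Type*} [NormedAddCommGroup E] [CompleteSpace E]
    {T : E → E} {x₀ : E} {δ κ : ℝ} (hκ0 : 0 ≤ κ) (hκ : κ < 1) (hδ : 0 ≤ δ)
    (hT : ∀ x ∈ Metric.closedBall x₀ δ, ∀ y ∈ Metric.closedBall x₀ δ,
      ‖T x - T y‖ ≤ κ * ‖x - y‖)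
    (h₀ : ‖T x₀ - x₀‖ ≤ (1 - κ) * δ) : ∃ x ∈ Metric.closedBall x₀ δ, T x = x := by
  have hmem : x₀ ∈ Metric.closedBall x₀ δ := Metric.mem_closedBall_self hδ
  have hmaps : MapsTo T (Metric.closedBall x₀ δ) (Metric.closedBall x₀ δ) := by
    intro x hx
    have h1 := hT x hx x₀ hmem
    rw [mem_closedBall_iff_norm] at hx ⊢
    calc ‖T x - x₀‖ = ‖(T x - T x₀) + (T x₀ - x₀)‖ := by rw [sub_add_sub_cancel]
      _ ≤ κ * δ + (1 - κ) * δ := (norm_add_le _ _).trans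
          (add_le_add (h1.trans (by gcongr)) h₀)
      _ = δ := by ring
  have hc : ContractingWith ⟨κ, hκ0⟩ (hmaps.restrict T _ _) := by
    refine ⟨by exact_mod_cast hκ, LipschitzWith.of_dist_le_mul fun x y => ?_⟩
    have := hT x x.2 y y.2
    rw [← dist_eq_norm, ← dist_eq_norm] at this
    exact this
  obtain ⟨x, hx, hfix, -⟩ := ContractingWith.exists_fixedPoint' Metric.isClosed_closedBall.isComplete
    hmaps hc hmem (edist_ne_top _ _)
  exact ⟨x, hx, hfix⟩

namespace LaplaceFamily

variable {ι : Type*} [Fintype ι] (L : LaplaceFamily ι)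

/-- Here s₀ is a fixed point of the limiting affine map. The value expansion bounds how far the true
map moves s₀, and the difference expansion bounds its Lipschitz constant, each up to O(r). -/
theorem exists_selfConsistent {f : ι → ℝ → ℝ} {b s₀ : ι → ℝ} {δ : ℝ}
    (hf : ∀ i, ContDiff ℝ ∞ (f i)) (h0 : ∀ i, PolyO L.a 0 (f i))
    (hb : ∀ i, 0 < b i) (hfb : ∀ i, deriv (f i) L.a = b i)
    (hcontr : ∑ i, |L.γ i| * b i < L.w)
    (hs₀ : ∀ i, s₀ i = -b i * ((∑ j, s₀ j * L.γ j) / L.w + L.v / (2 * L.w ^ 2)) +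
      iteratedDeriv 2 (f i) L.a / (4 * L.w)) (hδ : 0 < δ) :
    ∃ B, ∀ᶠ r in nhdsWithin 0 (Ioi 0), ∃ s, (∀ i, |s i - s₀ i| ≤ δ) ∧ L.Dominated B r s ∧
      ∀ i, L.mean r s (f i) = f i L.a + r ^ 2 * s i := by
  have hw := L.w_pos
  set β : ℝ := ∑ i, b i with hβ
  have hbβ : ∀ i, b i ≤ β := fun i =>
    Finset.single_le_sum (f := b) (fun i _ => (hb i).le) (Finset.mem_univ i)
  have hβ0 : 0 ≤ β := Finset.sum_nonneg fun i _ => (hb i).le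
  set β' : ℝ := ∑ i, (b i)⁻¹ with hβ'
  have hbβ' : ∀ i, (b i)⁻¹ ≤ β' := fun i =>
    Finset.single_le_sum (f := fun i => (b i)⁻¹) (fun i _ => (inv_pos.2 (hb i)).le)
      (Finset.mem_univ i)
  have hβ'0 : 0 ≤ β' := Finset.sum_nonneg fun i _ => (inv_pos.2 (hb i)).le
  set θ : ℝ := (∑ i, |L.γ i| * b i) / L.w with hθ
  have hθ0 : 0 ≤ θ := div_nonneg
    (Finset.sum_nonneg fun i _ => mul_nonneg (abs_nonneg _) (hb i).le) hw.le
  have hθ1 : θ < 1 := by rwa [hθ, div_lt_one hw]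
  -- Midway between θ and 1: the gap κ - θ = 1 - κ is what the O(r) Lipschitz error may use.
  set κ : ℝ := (1 + θ) / 2 with hκ
  set δ' : ℝ := δ / (β + 1) with hδ'
  have hδ'0 : 0 < δ' := by positivity
  set R : ℝ := ‖s₀‖ + δ with hR
  obtain ⟨B, hB⟩ := L.exists_dominated R
  obtain ⟨K₁, hK₁, h₁⟩ := exists_forall_le
    (p := fun i K => ∀ r s, L.Dominated B r s →
      |L.mean r s (f i) - (f i L.a + r ^ 2 *
        (-deriv (f i) L.a * ((∑ i, s i * L.γ i) / L.w + L.v / (2 * L.w ^ 2)) +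
          iteratedDeriv 2 (f i) L.a / (4 * L.w)))| ≤ K * r ^ 3)
    (fun i => L.exists_mean_expansion B (hf i) (h0 i))
    (fun i K K' h hx r s hd => (hx r s hd).trans (by have := hd.pos; gcongr))
  obtain ⟨K₂, hK₂, h₂⟩ := exists_forall_le
    (p := fun i K => ∀ r s s', L.Dominated B r s → L.Dominated B r s' →
      |L.mean r s' (f i) - L.mean r s (f i) +
        r ^ 2 * (deriv (f i) L.a * ((∑ i, (s' i - s i) * L.γ i) / L.w))|
          ≤ K * ‖s' - s‖ * r ^ 3)
    (fun i => L.exists_mean_sub_expansion B (hf i) (h0 i))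
    (fun i K K' h hx r s s' hd hd' => (hx r s s' hd hd').trans (by have := hd.pos; gcongr))
  refine ⟨B, ?_⟩
  have hκ1 : 0 < 1 - κ := by rw [hκ]; linarith
  filter_upwards [hB, self_mem_nhdsWithin,
    eventually_const_mul_le (K := K₁ * β') (η := (1 - κ) * δ') (by positivity) (by positivity),
    eventually_const_mul_le (K := K₂ * β * β') (η := 1 - κ) (by positivity) hκ1]
    with r hdom hr hsm₁ hsm₂
  have hr : 0 < r := hr
  -- Coordinates t_i = s_i / b_i. The limiting linear part is rank one with range spanned by b, so
  -- after this rescaling its sup-norm Lipschitz constant is at most θ = (∑ |γ_j| b_j) / w.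
  let S : (ι → ℝ) → ι → ℝ := fun t i => b i * t i
  let T : (ι → ℝ) → ι → ℝ := fun t i => (L.mean r (S t) (f i) - f i L.a) / (r ^ 2 * b i)
  let t₀ : ι → ℝ := fun i => s₀ i / b i
  have hSt₀ : S t₀ = s₀ := funext fun i => by
    have := (hb i).ne'
    simp only [S, t₀]; field_simp
  have hclose : ∀ t ∈ Metric.closedBall t₀ δ', ∀ i, |S t i - s₀ i| ≤ δ := by
    intro t ht i
    rw [mem_closedBall_iff_norm] at ht
    rw [← hSt₀]
    simp only [S, ← mul_sub]
    rw [abs_mul, abs_of_pos (hb i)]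
    calc b i * |t i - t₀ i| ≤ (β + 1) * δ' := by
          gcongr
          · linarith [hbβ i]
          · exact (norm_le_pi_norm (t - t₀) i).trans ht
      _ = δ := by rw [hδ']; field_simp
  have hSdom : ∀ t ∈ Metric.closedBall t₀ δ', L.Dominated B r (S t) := by
    intro t ht
    apply hdom
    have : ‖S t - s₀‖ ≤ δ := (pi_norm_le_iff_of_nonneg hδ.le).2 fun i => hclose t ht i
    calc ‖S t‖ = ‖s₀ + (S t - s₀)‖ := by rw [add_sub_cancel]
      _ ≤ R := (norm_add_le _ _).trans (by rw [hR]; gcongr)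
  have hmem : t₀ ∈ Metric.closedBall t₀ δ' := Metric.mem_closedBall_self hδ'0.le
  have hlip : ∀ x ∈ Metric.closedBall t₀ δ', ∀ y ∈ Metric.closedBall t₀ δ',
      ‖T x - T y‖ ≤ κ * ‖x - y‖ := by
    intro x hx y hy
    rw [pi_norm_le_iff_of_nonneg (by positivity)]
    intro i
    have hbi := hb i
    have key := h₂ i r (S y) (S x) (hSdom y hy) (hSdom x hx)
    have hSS : ‖S x - S y‖ ≤ β * ‖x - y‖ := by
      rw [pi_norm_le_iff_of_nonneg (by positivity)]
      intro j
      simp only [Pi.sub_apply, S, ← mul_sub]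
      rw [Real.norm_eq_abs, abs_mul, abs_of_pos (hb j)]
      exact mul_le_mul (hbβ j) (norm_le_pi_norm (x - y) j) (abs_nonneg _) hβ0
    have hγ : |(∑ j, (S x j - S y j) * L.γ j) / L.w| ≤ θ * ‖x - y‖ := by
      rw [abs_div, abs_of_pos hw, hθ, div_mul_eq_mul_div, Finset.sum_mul]
      gcongr
      refine (Finset.abs_sum_le_sum_abs _ _).trans (Finset.sum_le_sum fun j _ => ?_)
      simp only [S, ← mul_sub]
      rw [abs_mul, abs_mul, abs_of_pos (hb j), mul_comm, mul_assoc]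
      gcongr
      · exact (hb j).le
      · exact norm_le_pi_norm (x - y) j
    rw [hfb i] at key
    have e : (T x - T y) i = (L.mean r (S x) (f i) - L.mean r (S y) (f i) +
        r ^ 2 * (b i * ((∑ j, (S x j - S y j) * L.γ j) / L.w))) / (r ^ 2 * b i) -
        (∑ j, (S x j - S y j) * L.γ j) / L.w := by
      simp only [T, Pi.sub_apply]
      field_simp
      ring
    rw [e, Real.norm_eq_abs]
    calc _ ≤ K₂ * ‖S x - S y‖ * r ^ 3 / (r ^ 2 * b i) + θ * ‖x - y‖ := by
          refine (abs_sub _ _).trans (add_le_add ?_ hγ)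
          rw [abs_div, abs_of_pos (by positivity : 0 < r ^ 2 * b i)]
          gcongr
      _ = K₂ * ‖S x - S y‖ * r * (b i)⁻¹ + θ * ‖x - y‖ := by field_simp
      _ ≤ K₂ * (β * ‖x - y‖) * r * β' + θ * ‖x - y‖ := by
          gcongr
          exact hbβ' i
      _ = (K₂ * β * β' * r + θ) * ‖x - y‖ := by ring
      _ ≤ κ * ‖x - y‖ := by
          gcongr
          rw [hκ] at hsm₂ ⊢; linarith
  have hstart : ‖T t₀ - t₀‖ ≤ (1 - κ) * δ' := by
    rw [pi_norm_le_iff_of_nonneg (by positivity)]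
    intro i
    have hbi := hb i
    have key := h₁ i r s₀ (hSt₀ ▸ hSdom t₀ hmem)
    rw [hfb i, ← hs₀ i] at key
    have e : (T t₀ - t₀) i = (L.mean r s₀ (f i) - (f i L.a + r ^ 2 * s₀ i)) / (r ^ 2 * b i) := by
      simp only [T, Pi.sub_apply, hSt₀]
      simp only [t₀]
      field_simp
      ring
    rw [e, Real.norm_eq_abs, abs_div, abs_of_pos (by positivity : 0 < r ^ 2 * b i)]
    calc _ ≤ K₁ * r ^ 3 / (r ^ 2 * b i) := by gcongr
      _ = K₁ * (b i)⁻¹ * r := by field_simp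
      _ ≤ K₁ * β' * r := by gcongr; exact hbβ' i
      _ ≤ _ := hsm₁
  obtain ⟨t, ht, hfix⟩ := exists_fixedPoint_of_contraction (T := T) (x₀ := t₀) (δ := δ') (κ := κ)
    (by positivity) (by linarith) hδ'0.le hlip hstart
  refine ⟨S t, hclose t ht, hSdom t ht, fun i => ?_⟩
  have := congrFun hfix i
  have hbi := (hb i).ne'
  simp only [T] at this
  rw [div_eq_iff (by positivity)] at this
  simp only [S] at this ⊢
  linear_combination this

end LaplaceFamily

/-! ### Taylor formula and parity for polynomial derivatives. -/

section Polynomial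

variable (F : Polynomial ℝ)

theorem polyDeriv_zero (x : ℝ) : polyDeriv F 0 x = F.eval x := rfl

theorem hasDerivAt_polyDeriv (j : ℕ) (x : ℝ) :
    HasDerivAt (polyDeriv F j) (polyDeriv F (j + 1) x) x := by
  unfold polyDeriv
  rw [Function.iterate_succ_apply']
  exact Polynomial.hasDerivAt _ x

theorem contDiff_polyDeriv (j : ℕ) : ContDiff ℝ ∞ (polyDeriv F j) := by
  have := Polynomial.contDiff_aeval (Polynomial.derivative^[j] F) (∞ : WithTop ℕ∞) (𝕜 := ℝ)
  simp only [Polynomial.coe_aeval_eq_eval] at this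
  exact this

theorem polyO_polyDeriv (a : ℝ) (j : ℕ) : PolyO a 0 (polyDeriv F j) := PolyO.eval a _

theorem hasDerivAt_polyDeriv_sub (j : ℕ) (a x : ℝ) :
    HasDerivAt (fun x => polyDeriv F j (x - a)) (polyDeriv F (j + 1) (x - a)) x :=
  (hasDerivAt_polyDeriv F j (x - a)).comp_sub_const x a

theorem contDiff_polyDeriv_sub (j : ℕ) (a : ℝ) : ContDiff ℝ ∞ (fun x => polyDeriv F j (x - a)) :=
  (contDiff_polyDeriv F j).comp (contDiff_id.sub contDiff_const)

theorem polyO_polyDeriv_sub (a : ℝ) (j : ℕ) : PolyO a 0 (fun x => polyDeriv F j (x - a)) := by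
  have := PolyO.eval a ((Polynomial.derivative^[j] F).comp (Polynomial.X - Polynomial.C a))
  simpa [polyDeriv] using this

theorem polyDeriv_add {N : ℕ} (j : ℕ) (hN : F.natDegree < N + j) (x y : ℝ) :
    polyDeriv F j (x + y) =
      ∑ p ∈ Finset.range N, y ^ p / (p.factorial : ℝ) * polyDeriv F (p + j) x := by
  rcases Nat.eq_zero_or_pos N with rfl | hN0
  · have h0 : Polynomial.derivative^[j] F = 0 :=
      Polynomial.iterate_derivative_eq_zero (by omega)
    simp [polyDeriv, h0]
  have hdeg : (Polynomial.taylor x (Polynomial.derivative^[j] F)).natDegree < N := by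
    rw [Polynomial.natDegree_taylor]
    exact (Polynomial.natDegree_iterate_derivative F j).trans_lt (by omega)
  have h1 := Polynomial.taylor_eval x (Polynomial.derivative^[j] F) y
  rw [Polynomial.eval_eq_sum_range' hdeg, add_comm y x] at h1
  rw [polyDeriv, ← h1]
  refine Finset.sum_congr rfl fun p _ => ?_
  have h2 := congrFun (Polynomial.factorial_smul_hasseDeriv (R := ℝ) p)
    (Polynomial.derivative^[j] F)
  have h3 := congrArg (Polynomial.eval x) h2
  rw [← Function.iterate_add_apply] at h3
  rw [Polynomial.taylor_coeff, polyDeriv, ← h3]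
  have : (p.factorial : ℝ) ≠ 0 := by positivity
  rw [LinearMap.smul_apply, Polynomial.eval_smul, nsmul_eq_mul]
  field_simp

variable {F} in
theorem polyDeriv_neg (hF : ∀ x, F.eval (-x) = F.eval x) (j : ℕ) (x : ℝ) :
    polyDeriv F j (-x) = (-1) ^ j * polyDeriv F j x := by
  induction j generalizing x with
  | zero => simpa [polyDeriv] using hF x
  | succ j ih =>
    have h1 : HasDerivAt (fun x => polyDeriv F j (-x)) (-polyDeriv F (j + 1) (-x)) x := by
      have h := (hasDerivAt_polyDeriv F j (-x)).comp x (hasDerivAt_neg x)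
      rwa [mul_neg_one] at h
    have h2 := (hasDerivAt_polyDeriv F j x).const_mul ((-1) ^ j)
    rw [funext ih] at h1
    have := h1.unique h2
    rw [pow_succ]
    linarith

variable {F} in
theorem polyDeriv_zero_of_odd (hF : ∀ x, F.eval (-x) = F.eval x) {j : ℕ} (hj : Odd j) :
    polyDeriv F j 0 = 0 := by
  have := polyDeriv_neg hF j 0
  rw [hj.neg_one_pow, neg_zero] at this
  linarith

end Polynomial

/-! ### Strict minimum and growth of the interaction. -/

section Interaction

variable {F : Polynomial ℝ} {q n : ℕ} {C : ℝ}

theorem IsInteraction.eval_zero_le (hF : IsInteraction F q C) (y : ℝ) : F.eval 0 ≤ F.eval y := by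
  have := hF.convex.2 (mem_univ y) (mem_univ (-y)) (by norm_num : (0 : ℝ) ≤ 1 / 2)
    (by norm_num : (0 : ℝ) ≤ 1 / 2) (by norm_num)
  simp only [smul_eq_mul, hF.even] at this
  rw [show 1 / 2 * y + 1 / 2 * -y = 0 by ring] at this
  linarith

/-- Equality would, by convexity, make F constant on the segment from 0 to y; a polynomial constant
on an infinite set is constant, against its positive degree. -/
theorem IsInteraction.eval_zero_lt (hF : IsInteraction F q C) (hn : 1 ≤ n)
    (hdeg : F.natDegree = 2 * n) {y : ℝ} (hy : y ≠ 0) : F.eval 0 < F.eval y := by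
  refine lt_of_le_of_ne (hF.eval_zero_le y) fun heq => ?_
  have hflat : ∀ t ∈ Icc (0 : ℝ) 1, F.eval (t * y) = F.eval 0 := fun t ht => by
    refine le_antisymm ?_ (hF.eval_zero_le _)
    have := hF.convex.2 (mem_univ y) (mem_univ 0) ht.1 (sub_nonneg.2 ht.2) (by ring)
    simp only [smul_eq_mul, ← heq, mul_zero, add_zero] at this
    linarith
  have hinf : {x | F.eval x = (Polynomial.C (F.eval 0)).eval x}.Infinite := by
    refine (Set.infinite_of_injective_forall_mem (f := fun k : ℕ => (1 / ((k : ℝ) + 1)) * y)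
      (fun k l hkl => ?_) fun k => ?_)
    · have := mul_right_cancel₀ hy hkl
      simpa using this
    · have : 1 / ((k : ℝ) + 1) ≤ 1 := by
        rw [div_le_one (by positivity)]; linarith [Nat.cast_nonneg (α := ℝ) k]
      simpa using hflat _ ⟨by positivity, this⟩
  have := Polynomial.eq_of_infinite_eval_eq _ _ hinf
  rw [this, Polynomial.natDegree_C] at hdeg
  omega

/-- The quotient of F - F(0) by y^(2n) tends to the leading coefficient, which is nonzero and a
limit of nonnegative numbers. Evenness covers negative y. -/
theorem IsInteraction.exists_growth (hF : IsInteraction F q C) (hn : 1 ≤ n)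
    (hdeg : F.natDegree = 2 * n) :
    ∃ c > 0, ∃ Y ≥ 1, ∀ y : ℝ, Y ≤ |y| → c * y ^ (2 * n) ≤ F.eval y - F.eval 0 := by
  set P := F - Polynomial.C (F.eval 0) with hP
  have hPdeg : P.natDegree = 2 * n := by rw [hP, Polynomial.natDegree_sub_C, hdeg]
  have hP0 : P ≠ 0 := by rintro h; rw [h, Polynomial.natDegree_zero] at hPdeg; omega
  have hlim := Polynomial.div_tendsto_atTop_leadingCoeff_div_of_degree_eq P
    (Polynomial.X ^ (2 * n)) (by
      rw [Polynomial.degree_X_pow, Polynomial.degree_eq_natDegree hP0, hPdeg])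
  simp only [hP, Polynomial.eval_sub, Polynomial.eval_C, Polynomial.eval_pow, Polynomial.eval_X,
    Polynomial.leadingCoeff_X_pow, div_one] at hlim
  rw [← hP] at hlim
  have hlc : 0 < P.leadingCoeff := by
    refine lt_of_le_of_ne ?_ (Polynomial.leadingCoeff_ne_zero.2 hP0).symm
    refine ge_of_tendsto hlim (Eventually.of_forall fun y => ?_)
    refine div_nonneg (sub_nonneg.2 (hF.eval_zero_le y)) ?_
    rw [pow_mul]; positivity
  obtain ⟨Y, hY⟩ := eventually_atTop.1 (hlim.eventually (eventually_ge_nhds (half_lt_self hlc)))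
  refine ⟨P.leadingCoeff / 2, by positivity, max Y 1, le_max_right _ _, fun y hy => ?_⟩
  have h1 := hY |y| ((le_max_left _ _).trans hy)
  have hy1 : 1 ≤ |y| := (le_max_right _ _).trans hy
  rw [le_div_iff₀ (by positivity), (even_two_mul n).pow_abs] at h1
  have : F.eval |y| = F.eval y := by
    rcases abs_choice y with h | h <;> rw [h]
    exact hF.even y
  rwa [this] at h1

end Interaction

theorem PolyO.of_abs_le {a : ℝ} {j : ℕ} {φ ψ : ℝ → ℝ} (hφ : Continuous φ) (hψ : PolyO a j ψ)
    (h : ∀ x, |φ x| ≤ |ψ x|) : PolyO a j φ := by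
  obtain ⟨-, K, M, hK, hb⟩ := hψ
  exact ⟨hφ, K, M, hK, fun x => (h x).trans (hb x)⟩

/-! ### Regularity and growth of the double well. -/

section DoubleWell

variable {V : ℝ → ℝ} {a C : ℝ} {q : ℕ}

theorem IsDoubleWell.contDiff_deriv (hV : IsDoubleWell V a q C) : ContDiff ℝ ∞ (deriv V) :=
  (contDiff_infty_iff_deriv.1 hV.smooth).2

theorem IsDoubleWell.hasDerivAt (hV : IsDoubleWell V a q C) (x : ℝ) :
    HasDerivAt V (deriv V x) x := (hV.smooth.differentiable (by simp) x).hasDerivAt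

theorem IsDoubleWell.polyO_deriv (hV : IsDoubleWell V a q C) (b : ℝ) : PolyO b 0 (deriv V) := by
  refine PolyO.of_abs_le hV.contDiff_deriv.continuous
    (((PolyO.const 1).add (PolyO.id_pow b (2 * q))).const_mul C) fun x => ?_
  exact (hV.growth x).trans (le_abs_self _)

theorem IsDoubleWell.polyO (hV : IsDoubleWell V a q C) (hC : 0 < C) (b : ℝ) : PolyO b 0 V := by
  have h1 : PolyO b 0 (fun x => x) := by simpa using PolyO.id_pow b 1
  refine PolyO.of_abs_le hV.smooth.continuous
    ((((PolyO.const 1).add (PolyO.id_pow b (2 * q))).const_mul C).mul h1) fun x => ?_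
  have key := Convex.norm_image_sub_le_of_norm_hasDerivWithin_le (f := V) (f' := deriv V)
    (s := Icc (-|x|) |x|) (x := 0) (y := x) (C := C * (1 + x ^ (2 * q)))
    (fun z _ => (hV.hasDerivAt z).hasDerivWithinAt)
    (fun z hz => by
      refine (hV.growth z).trans ?_
      have hz' : |z| ≤ |x| := abs_le.2 hz
      have : z ^ (2 * q) ≤ x ^ (2 * q) := by
        rw [← (even_two_mul q).pow_abs z, ← (even_two_mul q).pow_abs x]
        gcongr
      gcongr)
    (convex_Icc _ _) ⟨by simp, by simp⟩ ⟨neg_abs_le x, le_abs_self x⟩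
  rw [hV.zero, sub_zero, sub_zero, Real.norm_eq_abs, Real.norm_eq_abs] at key
  refine key.trans ?_
  rw [abs_mul]
  gcongr
  exact le_abs_self _

end DoubleWell

/-! ### The phase at the well a and its Laplace family. -/

section Phase

variable {V : ℝ → ℝ} {F : Polynomial ℝ} {a C : ℝ} {q n : ℕ}

/-- The unperturbed phase `V + F(· - a)`, normalised to vanish at `a`. -/
def phase (V : ℝ → ℝ) (F : Polynomial ℝ) (a x : ℝ) : ℝ :=
  V x + polyDeriv F 0 (x - a) - (V a + polyDeriv F 0 0)

/-- The derivative of `phase`. -/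
def phaseDeriv (V : ℝ → ℝ) (F : Polynomial ℝ) (a x : ℝ) : ℝ :=
  deriv V x + polyDeriv F 1 (x - a)

theorem hasDerivAt_phase (hV : IsDoubleWell V a q C) (x : ℝ) :
    HasDerivAt (phase V F a) (phaseDeriv V F a x) x :=
  ((hV.hasDerivAt x).add (hasDerivAt_polyDeriv_sub F 0 a x)).sub_const _

theorem contDiff_phase (hV : IsDoubleWell V a q C) : ContDiff ℝ ∞ (phase V F a) :=
  (hV.smooth.add (contDiff_polyDeriv_sub F 0 a)).sub contDiff_const

theorem contDiff_phaseDeriv (hV : IsDoubleWell V a q C) : ContDiff ℝ ∞ (phaseDeriv V F a) :=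
  hV.contDiff_deriv.add (contDiff_polyDeriv_sub F 1 a)

theorem phase_self : phase V F a a = 0 := by simp [phase]

theorem phaseDeriv_self (hV : IsDoubleWell V a q C) (hF : IsInteraction F q C) :
    phaseDeriv V F a a = 0 := by
  rw [phaseDeriv, (hV.critical a).2 (Or.inl rfl), sub_self,
    polyDeriv_zero_of_odd hF.even odd_one, add_zero]

theorem deriv_phase (hV : IsDoubleWell V a q C) : deriv (phase V F a) = phaseDeriv V F a :=
  funext fun x => (hasDerivAt_phase hV x).deriv

theorem deriv_phaseDeriv (hV : IsDoubleWell V a q C) :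
    deriv (phaseDeriv V F a) = fun x => iteratedDeriv 2 V x + polyDeriv F 2 (x - a) := by
  funext x
  rw [iteratedDeriv_succ, iteratedDeriv_one]
  exact (((hV.contDiff_deriv.differentiable (by simp)) x).hasDerivAt.add
    (hasDerivAt_polyDeriv_sub F 1 a x)).deriv

theorem iteratedDeriv_two_phaseDeriv (hV : IsDoubleWell V a q C) :
    iteratedDeriv 2 (phaseDeriv V F a) =
      fun x => iteratedDeriv 3 V x + polyDeriv F 3 (x - a) := by
  funext x
  rw [iteratedDeriv_succ, iteratedDeriv_one, deriv_phaseDeriv hV, iteratedDeriv_succ (n := 2)]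
  have : ContDiff ℝ ∞ (deriv (deriv V)) := (contDiff_infty_iff_deriv.1 hV.contDiff_deriv).2
  have h2 : iteratedDeriv 2 V = deriv (deriv V) := by rw [iteratedDeriv_succ, iteratedDeriv_one]
  rw [h2]
  exact (((this.differentiable (by simp)) x).hasDerivAt.add
    (hasDerivAt_polyDeriv_sub F 2 a x)).deriv

theorem iteratedDeriv_two_phase (hV : IsDoubleWell V a q C) :
    iteratedDeriv 2 (phase V F a) a = alpha F + iteratedDeriv 2 V a := by
  rw [iteratedDeriv_succ, iteratedDeriv_one, deriv_phase hV, deriv_phaseDeriv hV, alpha, add_comm]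
  simp only [sub_self]

theorem polyO_phase (hC : 0 < C) (hV : IsDoubleWell V a q C) : PolyO a 0 (phase V F a) :=
  ((hV.polyO hC a).add (polyO_polyDeriv_sub F a 0)).sub (PolyO.const _)

theorem polyO_phaseDeriv (hV : IsDoubleWell V a q C) : PolyO a 0 (phaseDeriv V F a) :=
  (hV.polyO_deriv a).add (polyO_polyDeriv_sub F a 1)

/-- Three regimes: near a the quadratic Taylor term rules; at intermediate distances compactness and
the strict minimum of F at 0 give a positive lower bound; far away F grows like the power 2n. In the
last two, V ≥ V(a) discards V. -/
theorem exists_phase_lower (hV : IsDoubleWell V a q C) (hF : IsInteraction F q C) (hn : 1 ≤ n)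
    (hdeg : F.natDegree = 2 * n) (hw : 0 < alpha F + iteratedDeriv 2 V a) :
    ∃ c > 0, ∀ x, c * ((x - a) ^ 2 + (x - a) ^ (2 * n)) ≤ phase V F a x := by
  obtain ⟨c₂, hc₂, Y, hY, hfar⟩ := hF.exists_growth hn hdeg
  obtain ⟨K, hK, hnear⟩ := taylor_local_bound a 3 (phase V F a) (contDiff_phase hV)
  set w := alpha F + iteratedDeriv 2 V a with hwdef
  -- Within this radius the cubic remainder is at most (w/4)(x - a)², half of the quadratic term
  -- (w/2)(x - a)².
  set ρ : ℝ := min 1 (w / (4 * (K + 1))) with hρ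
  have hρ0 : 0 < ρ := lt_min one_pos (by positivity)
  have hge : ∀ x, polyDeriv F 0 (x - a) - polyDeriv F 0 0 ≤ phase V F a x := fun x => by
    have := hV.bottom x
    simp only [phase]; linarith
  have hcomp : IsCompact (Icc (a - Y) (a + Y) ∩ {x | ρ ≤ |x - a|}) :=
    isCompact_Icc.inter_right (isClosed_le continuous_const (by fun_prop))
  obtain ⟨c₃, hc₃, hmid⟩ := hcomp.exists_forall_le' (f := phase V F a) (a := 0)
    (contDiff_phase hV).continuous.continuousOn (fun x hx => by
      refine lt_of_lt_of_le ?_ (hge x)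
      have : x - a ≠ 0 := by
        have := hρ0.trans_le hx.2
        exact abs_pos.1 this
      exact sub_pos.2 (hF.eval_zero_lt hn hdeg this))
  have hYn : 0 < Y ^ (2 * n) := by positivity
  refine ⟨min (w / 8) (min (c₂ / 2) (c₃ / (2 * Y ^ (2 * n)))),
    lt_min (by positivity) (lt_min (by positivity) (by positivity)), fun x => ?_⟩
  have hpn : 0 ≤ (x - a) ^ (2 * n) := by rw [pow_mul]; positivity
  have habs : (x - a) ^ (2 * n) = |x - a| ^ (2 * n) := ((even_two_mul n).pow_abs _).symm
  have habs2 : (x - a) ^ 2 = |x - a| ^ 2 := (sq_abs _).symm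
  have hn2 : 2 ≤ 2 * n := by omega
  rcases le_total |x - a| ρ with hx | hx
  · have hx1 : |x - a| ≤ 1 := hx.trans (min_le_left _ _)
    have h1 := hnear x hx1
    simp only [Finset.sum_range_succ, Finset.sum_range_zero, iteratedDeriv_zero, iteratedDeriv_one,
      phase_self, deriv_phase hV, phaseDeriv_self hV hF, iteratedDeriv_two_phase hV] at h1
    rw [← hwdef] at h1
    have h2 := (abs_le.1 h1).1
    have h3 : K * |x - a| ^ 3 ≤ w / 4 * (x - a) ^ 2 := by
      have h4 : |x - a| * (4 * (K + 1)) ≤ w := by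
        have := hx.trans (min_le_right _ _)
        rwa [le_div_iff₀ (by positivity)] at this
      have h5 : K * |x - a| ≤ w / 4 := by nlinarith [abs_nonneg (x - a)]
      calc K * |x - a| ^ 3 = K * |x - a| * (x - a) ^ 2 := by rw [habs2]; ring
        _ ≤ _ := by gcongr
    have h6 : (x - a) ^ (2 * n) ≤ (x - a) ^ 2 := by
      rw [habs, habs2]; exact pow_le_pow_of_le_one (abs_nonneg _) hx1 hn2
    calc _ ≤ w / 8 * ((x - a) ^ 2 + (x - a) ^ 2) := by
          gcongr; exact min_le_left _ _
      _ ≤ _ := by norm_num at h2; linarith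
  · rcases le_total |x - a| Y with hx' | hx'
    · have hmem : x ∈ Icc (a - Y) (a + Y) ∩ {x | ρ ≤ |x - a|} := by
        have := abs_le.1 hx'
        exact ⟨⟨by linarith [this.1], by linarith [this.2]⟩, hx⟩
      have h1 : (x - a) ^ (2 * n) ≤ Y ^ (2 * n) := by rw [habs]; gcongr
      have h2 : (x - a) ^ 2 ≤ Y ^ (2 * n) := by
        rw [habs2]
        calc |x - a| ^ 2 ≤ Y ^ 2 := by gcongr
          _ ≤ Y ^ (2 * n) := pow_le_pow_right₀ hY hn2
      calc _ ≤ c₃ / (2 * Y ^ (2 * n)) * (Y ^ (2 * n) + Y ^ (2 * n)) := by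
            gcongr
            exact (min_le_right _ _).trans (min_le_right _ _)
        _ = c₃ := by field_simp; ring
        _ ≤ _ := hmid x hmem
    · have h1 : (x - a) ^ 2 ≤ (x - a) ^ (2 * n) := by
        rw [habs, habs2]; exact pow_le_pow_right₀ (hY.trans hx') hn2
      calc _ ≤ c₂ / 2 * ((x - a) ^ (2 * n) + (x - a) ^ (2 * n)) := by
            gcongr
            exact (min_le_right _ _).trans (min_le_left _ _)
        _ = c₂ * (x - a) ^ (2 * n) := by ring
        _ ≤ _ := (hfar _ hx').trans (hge x)

theorem exists_abs_polyDeriv_sub_le {j : ℕ} (hj : 1 ≤ j) (hdeg : F.natDegree = 2 * n) (a : ℝ) :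
    ∃ K, 0 ≤ K ∧ ∀ x, |polyDeriv F j x - polyDeriv F j a| ≤
      K * (|x - a| + (x - a) ^ (2 * n)) := by
  refine ⟨∑ p ∈ Finset.range (2 * n), |polyDeriv F (p + 1 + j) a|,
    Finset.sum_nonneg fun p _ => abs_nonneg _, fun x => ?_⟩
  have h := polyDeriv_add F (N := 2 * n + 1) j (by omega) a (x - a)
  rw [add_sub_cancel, Finset.sum_range_succ'] at h
  simp only [pow_zero, Nat.factorial_zero, Nat.cast_one, div_one, one_mul, zero_add] at h
  rw [h, add_sub_cancel_right, Finset.sum_mul]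
  refine (Finset.abs_sum_le_sum_abs _ _).trans (Finset.sum_le_sum fun p hp => ?_)
  rw [Finset.mem_range] at hp
  have hp1 : |x - a| ^ (p + 1) ≤ |x - a| + (x - a) ^ (2 * n) := by
    rw [← (even_two_mul n).pow_abs]
    have h1 := pow_le_one_add_pow (abs_nonneg (x - a)) (show p ≤ 2 * n - 1 by omega)
    have h2 : |x - a| ^ (2 * n) = |x - a| * |x - a| ^ (2 * n - 1) := by
      rw [← pow_succ']; congr 1; omega
    rw [h2, pow_succ']
    nlinarith [abs_nonneg (x - a)]
  have hf : (1 : ℝ) ≤ ((p + 1).factorial : ℝ) := by exact_mod_cast Nat.factorial_pos (p + 1)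
  rw [abs_mul, abs_div, abs_pow, abs_of_pos (by positivity : (0 : ℝ) < ((p + 1).factorial : ℝ)),
    mul_comm]
  gcongr
  exact (div_le_self (by positivity) hf).trans hp1

/-- The coefficient `(-1)^p / p!` with `p = i + 1`. -/
def interactionCoeff (i : ℕ) : ℝ := (-1) ^ (i + 1) / ((i + 1).factorial : ℝ)

/-- The family of densities attached to the moment vectors near `(a ^ k)`. -/
def laplaceFamily (hC : 0 < C) (hV : IsDoubleWell V a q C) (hF : IsInteraction F q C) (hn : 1 ≤ n)
    (hdeg : F.natDegree = 2 * n) (hw : 0 < alpha F + iteratedDeriv 2 V a) :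
    LaplaceFamily (Fin (2 * n - 1)) where
  a := a
  w := alpha F + iteratedDeriv 2 V a
  -- The interaction contributes nothing, because F'''(0) = 0 by parity.
  v := iteratedDeriv 3 V a / 2
  c := (exists_phase_lower hV hF hn hdeg hw).choose
  n := n
  U := phase V F a
  U' := phaseDeriv V F a
  -- Subtracting the value at a only multiplies the density by a constant, and makes the
  -- perturbation vanish at a.
  g i x := interactionCoeff i * (polyDeriv F (i + 1) x - polyDeriv F (i + 1) a)
  g' i x := interactionCoeff i * polyDeriv F (i + 2) x
  γ i := interactionCoeff i * polyDeriv F (i + 2) a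
  w_pos := hw
  c_pos := (exists_phase_lower hV hF hn hdeg hw).choose_spec.1
  hasDeriv_U := hasDerivAt_phase hV
  lower := (exists_phase_lower hV hF hn hdeg hw).choose_spec.2
  upper := by
    have := PolyO.taylor_two (contDiff_phase hV) (polyO_phase (F := F) hC hV)
    simpa [phase_self, deriv_phase hV, phaseDeriv_self hV hF] using this
  U'_expansion := by
    have := PolyO.taylor_three (contDiff_phaseDeriv hV) (polyO_phaseDeriv (F := F) hV)
    simpa [deriv_phaseDeriv hV, phaseDeriv_self hV hF, iteratedDeriv_two_phaseDeriv hV, alpha,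
      polyDeriv_zero_of_odd hF.even (by decide : Odd 3), add_comm] using this
  hasDeriv_g i x := ((hasDerivAt_polyDeriv F (i + 1) x).sub_const _).const_mul _
  g_polyO i := (PolyO.taylor_one (contDiff_polyDeriv F _) (polyO_polyDeriv F a _)).const_mul _
  g_bound i := by
    obtain ⟨K, hK, h⟩ := exists_abs_polyDeriv_sub_le (F := F) (j := i + 1) (by omega) hdeg a
    refine ⟨|interactionCoeff i| * K, by positivity, fun x => ?_⟩
    rw [abs_mul, mul_assoc]
    exact mul_le_mul_of_nonneg_left (h x) (abs_nonneg _)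
  g'_expansion i := by
    simpa [mul_sub] using (PolyO.taylor_one (contDiff_polyDeriv F (i + 2))
      (polyO_polyDeriv F a (i + 2))).const_mul (interactionCoeff i)

end Phase

variable {V : ℝ → ℝ} {F : Polynomial ℝ} {a C : ℝ} {q n : ℕ}

/-! ### The linear system for the first-order coefficients. -/

section Cramer

theorem interactionCoeff_mul (i : ℕ) (a : ℝ) :
    interactionCoeff i * (((i : ℝ) + 1) * a ^ i) = -((-a) ^ i / (i.factorial : ℝ)) := by
  have h1 : (i.factorial : ℝ) ≠ 0 := by positivity
  have h2 : (i : ℝ) + 1 ≠ 0 := by positivity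
  rw [interactionCoeff, Nat.factorial_succ, neg_pow a, pow_succ]
  push_cast
  field_simp

/-- The sum is, up to sign, the Taylor expansion of F'' about a evaluated at 0; its length 2n - 1
exhausts the degree of F''. -/
theorem sum_interaction (hn : 1 ≤ n) (hdeg : F.natDegree = 2 * n) (a : ℝ) :
    ∑ i : Fin (2 * n - 1), interactionCoeff i * polyDeriv F (i + 2) a * (((i : ℝ) + 1) * a ^ (i : ℕ))
      = -alpha F := by
  have h := polyDeriv_add F (N := 2 * n - 1) 2 (by omega) a (-a)
  rw [add_neg_cancel, Finset.sum_range] at h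
  rw [alpha, h, ← Finset.sum_neg_distrib]
  refine Finset.sum_congr rfl fun i _ => ?_
  rw [mul_right_comm, interactionCoeff_mul, neg_mul]

/-- The factor i cancels one step of i!, leaving a times the Taylor expansion of F''' about a
evaluated at 0, which is zero by parity. -/
theorem sum_interaction_mul_index (hF : ∀ x, F.eval (-x) = F.eval x) (hn : 1 ≤ n)
    (hdeg : F.natDegree = 2 * n) (a : ℝ) :
    ∑ i : Fin (2 * n - 1),
      interactionCoeff i * polyDeriv F (i + 2) a * (((i : ℝ) + 1) * a ^ (i : ℕ) * i) = 0 := by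
  have h := polyDeriv_add F (N := 2 * n - 2) 3 (by omega) a (-a)
  rw [add_neg_cancel, polyDeriv_zero_of_odd hF (by decide : Odd 3)] at h
  rw [← Finset.sum_range (fun i : ℕ =>
    interactionCoeff i * polyDeriv F (i + 2) a * (((i : ℝ) + 1) * a ^ i * i)),
    show 2 * n - 1 = 2 * n - 2 + 1 by omega, Finset.sum_range_succ']
  simp only [Nat.cast_zero, mul_zero, add_zero]
  rw [← mul_zero a, h, Finset.mul_sum]
  refine Finset.sum_congr rfl fun i _ => ?_
  rw [← mul_assoc, mul_right_comm (interactionCoeff _), interactionCoeff_mul, Nat.factorial_succ]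
  have h1 : (i.factorial : ℝ) ≠ 0 := by positivity
  push_cast
  rw [show i + 1 + 2 = i + 3 by ring]
  field_simp
  ring

/-- Splits τ⁰ along the two vectors whose pairings with the interaction coefficients are given by
the two preceding sums. -/
theorem tau_eq (ha : 0 < a) (hV2 : 0 < iteratedDeriv 2 V a)
    (hw : 0 < alpha F + iteratedDeriv 2 V a) (i : Fin (2 * n - 1)) :
    tau V F a n i =
      iteratedDeriv 3 V a / (4 * iteratedDeriv 2 V a * (alpha F + iteratedDeriv 2 V a)) *
        (((i : ℝ) + 1) * a ^ (i : ℕ)) -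
      1 / (4 * a * (alpha F + iteratedDeriv 2 V a)) * (((i : ℝ) + 1) * a ^ (i : ℕ) * i) := by
  rw [tau]
  field_simp

theorem isCramerSolution_tau (hV : IsDoubleWell V a q C) (hF : IsInteraction F q C) (hn : 1 ≤ n)
    (hdeg : F.natDegree = 2 * n) (hw : 0 < alpha F + iteratedDeriv 2 V a) :
    IsCramerSolution V F a n (tau V F a n) := by
  intro k
  have ha := hV.a_pos
  have hV2 := hV.second_at_well
  have h1 := sum_interaction hn hdeg a
  have h2 := sum_interaction_mul_index hF.even hn hdeg a
  have e : ∑ p : Fin (2 * n - 1), (-1) ^ ((p : ℕ) + 1) / (((p : ℕ) + 1).factorial : ℝ)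
        * polyDeriv F ((p : ℕ) + 2) a * tau V F a n p =
      -(iteratedDeriv 3 V a / (4 * iteratedDeriv 2 V a * (alpha F + iteratedDeriv 2 V a)) *
        alpha F) := by
    calc _ = iteratedDeriv 3 V a / (4 * iteratedDeriv 2 V a * (alpha F + iteratedDeriv 2 V a)) *
          (∑ i : Fin (2 * n - 1),
            interactionCoeff i * polyDeriv F (i + 2) a * (((i : ℝ) + 1) * a ^ (i : ℕ))) -
          1 / (4 * a * (alpha F + iteratedDeriv 2 V a)) * ∑ i : Fin (2 * n - 1),
            interactionCoeff i * polyDeriv F (i + 2) a * (((i : ℝ) + 1) * a ^ (i : ℕ) * i) := by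
          rw [Finset.mul_sum, Finset.mul_sum, ← Finset.sum_sub_distrib]
          refine Finset.sum_congr rfl fun i _ => ?_
          rw [tau_eq ha hV2 hw, interactionCoeff]
          ring
      _ = _ := by rw [h1, h2]; ring
  rw [e, tau_eq ha hV2 hw]
  field_simp
  ring

/-- The matrix is diagonal plus a part with identical rows. A difference of solutions is therefore
-(P/w) k a^(k-1), with P its pairing with the common row; pairing again gives P w = P α, so P V''(a)
= 0. -/
theorem IsCramerSolution.eq (hV : IsDoubleWell V a q C) (hn : 1 ≤ n)
    (hdeg : F.natDegree = 2 * n) (hw : 0 < alpha F + iteratedDeriv 2 V a)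
    {τ σ : Fin (2 * n - 1) → ℝ} (hτ : IsCramerSolution V F a n τ)
    (hσ : IsCramerSolution V F a n σ) : τ = σ := by
  have ha := hV.a_pos
  have hV2 := hV.second_at_well
  set w := alpha F + iteratedDeriv 2 V a with hwdef
  set P := ∑ p : Fin (2 * n - 1), interactionCoeff p * polyDeriv F ((p : ℕ) + 2) a * (τ p - σ p)
    with hP
  have hPsub : P = (∑ p : Fin (2 * n - 1), (-1) ^ ((p : ℕ) + 1) / (((p : ℕ) + 1).factorial : ℝ)
        * polyDeriv F ((p : ℕ) + 2) a * τ p) -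
      ∑ p : Fin (2 * n - 1), (-1) ^ ((p : ℕ) + 1) / (((p : ℕ) + 1).factorial : ℝ)
        * polyDeriv F ((p : ℕ) + 2) a * σ p := by
    rw [← Finset.sum_sub_distrib, hP]
    exact Finset.sum_congr rfl fun i _ => by rw [mul_sub]; rfl
  have hdiff : ∀ k : Fin (2 * n - 1), τ k - σ k = -(P / w) * (((k : ℝ) + 1) * a ^ (k : ℕ)) := by
    intro k
    have h1 := hτ k
    have h2 := hσ k
    rw [← hwdef] at h1 h2
    have h3 : P + w / (((k : ℕ) + 1 : ℝ) * a ^ (k : ℕ)) * (τ k - σ k) = 0 := by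
      rw [hPsub]; linear_combination h1 - h2
    field_simp at h3 ⊢
    linarith
  have hP0 : P = P / w * alpha F := by
    have h1 := sum_interaction hn hdeg a
    calc P = -(P / w) * ∑ i : Fin (2 * n - 1),
            interactionCoeff i * polyDeriv F (i + 2) a * (((i : ℝ) + 1) * a ^ (i : ℕ)) := by
          rw [Finset.mul_sum]
          conv_lhs => rw [hP]
          exact Finset.sum_congr rfl fun i _ => by rw [hdiff i]; ring
      _ = _ := by rw [h1]; ring
  have hPz : P = 0 := by
    have h1 : P * iteratedDeriv 2 V a = 0 := by
      have : P * w = P * alpha F := by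
        conv_lhs => rw [hP0]
        field_simp
      rw [hwdef] at this
      linarith
    exact (mul_eq_zero.1 h1).resolve_right hV2.ne'
  funext k
  have := hdiff k
  rw [hPz] at this
  simp only [zero_div, neg_zero, zero_mul] at this
  linarith

end Cramer

/-! ### Fixed points yield stationary densities. -/

section Stationary

theorem sum_range_two_mul (hn : 1 ≤ n) (f : ℕ → ℝ) :
    ∑ p ∈ Finset.range (2 * n), f p = f 0 + ∑ i : Fin (2 * n - 1), f (i + 1) := by
  have h : Finset.range (2 * n) = Finset.range (2 * n - 1 + 1) := by congr 1; omega
  rw [h, Finset.sum_range_succ', Finset.sum_range, add_comm]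

/-- Expanding F(x - a) cancels the a^p of every order up to 2n - 1. Only the order 2n term survives,
and it is constant in x because F has degree 2n. -/
theorem Z_eq (hn : 1 ≤ n) (hdeg : F.natDegree = 2 * n) (m : Fin (2 * n - 1) → ℝ) (x : ℝ) :
    Z F a n m x = polyDeriv F 0 x +
      ∑ i : Fin (2 * n - 1), interactionCoeff i * m i * polyDeriv F (i + 1) x +
      a ^ (2 * n) / ((2 * n).factorial : ℝ) * polyDeriv F (2 * n) x := by
  have h := polyDeriv_add F (N := 2 * n + 1) 0 (by omega) x (-a)
  rw [Finset.sum_range_succ, sum_range_two_mul hn, ← sub_eq_add_neg, (even_two_mul n).neg_pow] at h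
  rw [Z, ← polyDeriv_zero, h]
  simp only [pow_zero, Nat.factorial_zero, Nat.cast_one, div_one, one_mul, add_zero]
  have : ∑ i : Fin (2 * n - 1), interactionCoeff i * m i * polyDeriv F (i + 1) x =
      ∑ i : Fin (2 * n - 1), (-a) ^ ((i : ℕ) + 1) / (((i : ℕ) + 1).factorial : ℝ) *
        polyDeriv F (i + 1) x +
      ∑ i : Fin (2 * n - 1), (-1) ^ ((i : ℕ) + 1) / (((i : ℕ) + 1).factorial : ℝ) *
        (m i - a ^ ((i : ℕ) + 1)) * polyDeriv F ((i : ℕ) + 1) x := by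
    rw [← Finset.sum_add_distrib]
    refine Finset.sum_congr rfl fun i _ => ?_
    rw [interactionCoeff, neg_pow a]
    ring
  rw [this]
  ring

theorem hasDerivAt_Z (hn : 1 ≤ n) (hdeg : F.natDegree = 2 * n) (m : Fin (2 * n - 1) → ℝ) (x : ℝ) :
    HasDerivAt (Z F a n m) (polyDeriv F 1 x +
      ∑ i : Fin (2 * n - 1), interactionCoeff i * m i * polyDeriv F (i + 2) x) x := by
  have h0 : polyDeriv F (2 * n + 1) x = 0 := by
    simp [polyDeriv, Polynomial.iterate_derivative_eq_zero (p := F) (x := 2 * n + 1) (by omega)]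
  have h1 : HasDerivAt (fun x => ∑ i : Fin (2 * n - 1),
      interactionCoeff i * m i * polyDeriv F (i + 1) x)
      (∑ i : Fin (2 * n - 1), interactionCoeff i * m i * polyDeriv F (i + 2) x) x :=
    HasDerivAt.fun_sum fun i _ => (hasDerivAt_polyDeriv F (i + 1) x).const_mul _
  have h2 := ((hasDerivAt_polyDeriv F 0 x).add h1).add
    ((hasDerivAt_polyDeriv F (2 * n) x).const_mul (a ^ (2 * n) / ((2 * n).factorial : ℝ)))
  rw [h0, mul_zero, add_zero] at h2
  exact h2.congr_of_eventuallyEq (Eventually.of_forall fun y => Z_eq hn hdeg m y)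

theorem contDiff_Z (m : Fin (2 * n - 1) → ℝ) : ContDiff ℝ ∞ (Z F a n m) :=
  (contDiff_polyDeriv_sub F 0 a).add
    (ContDiff.sum fun i _ => contDiff_const.mul (contDiff_polyDeriv F ((i : ℕ) + 1)))

theorem contDiff_assocDensity (hV : IsDoubleWell V a q C) (ε : ℝ) (m : Fin (2 * n - 1) → ℝ) :
    ContDiff ℝ ∞ (assocDensity V F a n ε m) :=
  ((contDiff_const.mul (hV.smooth.add (contDiff_Z m))).exp).div_const _

theorem hasDerivAt_assocDensity (hV : IsDoubleWell V a q C) (hn : 1 ≤ n)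
    (hdeg : F.natDegree = 2 * n) (ε : ℝ) (m : Fin (2 * n - 1) → ℝ) (x : ℝ) :
    HasDerivAt (assocDensity V F a n ε m) (-(2 / ε) * (assocDensity V F a n ε m x *
      (deriv V x + (polyDeriv F 1 x +
        ∑ i : Fin (2 * n - 1), interactionCoeff i * m i * polyDeriv F (i + 2) x)))) x := by
  have h := ((((hV.hasDerivAt x).add (hasDerivAt_Z (a := a) hn hdeg m x)).const_mul
    (-(2 / ε))).exp).div_const (∫ z, weight V F a n ε m z)
  refine h.congr_deriv ?_
  simp only [assocDensity, weight, Pi.add_apply]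
  ring

/-- The interaction term of a density only depends on its first `2n - 1` moments. -/
theorem integral_polyDeriv_sub_mul (hn : 1 ≤ n) (hdeg : F.natDegree = 2 * n) {u : ℝ → ℝ}
    {m : Fin (2 * n - 1) → ℝ} (hint : ∀ k : ℕ, Integrable (fun x => x ^ k * u x))
    (hmass : ∫ x, u x = 1) (hm : ∀ i : Fin (2 * n - 1), ∫ x, x ^ ((i : ℕ) + 1) * u x = m i)
    (x : ℝ) :
    ∫ y, polyDeriv F 1 (x - y) * u y = polyDeriv F 1 x +
      ∑ i : Fin (2 * n - 1), interactionCoeff i * m i * polyDeriv F (i + 2) x := by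
  have e : (fun y => polyDeriv F 1 (x - y) * u y) = fun y => ∑ p ∈ Finset.range (2 * n),
      ((-1) ^ p / (p.factorial : ℝ) * polyDeriv F (p + 1) x) * (y ^ p * u y) := by
    funext y
    rw [sub_eq_add_neg, polyDeriv_add F (N := 2 * n) 1 (by omega), Finset.sum_mul]
    refine Finset.sum_congr rfl fun p _ => ?_
    rw [neg_pow y]
    ring
  rw [e, integral_finsetSum _ fun p _ => (hint p).const_mul _]
  simp only [integral_const_mul]
  rw [sum_range_two_mul hn]
  simp only [pow_zero, Nat.factorial_zero, Nat.cast_one, div_one, one_mul, zero_add, hmass,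
    mul_one, hm, interactionCoeff]
  congr 1
  refine Finset.sum_congr rfl fun i _ => ?_
  rw [show (i : ℕ) + 1 + 1 = i + 2 by ring]
  ring

/-- At a fixed point the moments of the density are m itself, so F' * u is the derivative of Z_m.
The Gibbs form then gives the flux -(ε/2) u', which cancels the diffusion term. -/
theorem isInvariantFixedPoint_of_fixed (hV : IsDoubleWell V a q C) (hn : 1 ≤ n)
    (hdeg : F.natDegree = 2 * n) {ε : ℝ} (hε : 0 < ε) {m : Fin (2 * n - 1) → ℝ}
    (hint : ∀ k : ℕ, Integrable (fun x => x ^ k * weight V F a n ε m x))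
    (hfix : momentMap V F a n ε m = m) : IsInvariantFixedPoint V F a n ε m := by
  have hpos : 0 < ∫ x, weight V F a n ε m x := by
    have : Integrable (weight V F a n ε m) := by simpa using hint 0
    exact integral_exp_pos this
  have hmom : ∀ k : ℕ, Integrable (fun x => x ^ k * assocDensity V F a n ε m x) := fun k => by
    simpa only [assocDensity, mul_div_assoc] using (hint k).div_const (∫ z, weight V F a n ε m z)
  have hmass : ∫ x, assocDensity V F a n ε m x = 1 := by
    simp only [assocDensity]
    rw [integral_div, div_self hpos.ne']
  have hm : ∀ i : Fin (2 * n - 1), ∫ x, x ^ ((i : ℕ) + 1) * assocDensity V F a n ε m x = m i := by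
    intro i
    rw [← congrFun hfix i]
    simp only [assocDensity, momentMap, ← mul_div_assoc]
    rw [integral_div]
  have hu := contDiff_assocDensity (F := F) hV ε m
  have hu' : ContDiff ℝ ∞ (deriv (assocDensity V F a n ε m)) := (contDiff_infty_iff_deriv.1 hu).2
  have hflux : (fun x => assocDensity V F a n ε m x *
      (deriv V x + ∫ y, polyDeriv F 1 (x - y) * assocDensity V F a n ε m y)) =
      fun x => -(ε / 2) * deriv (assocDensity V F a n ε m) x := by
    funext x
    rw [integral_polyDeriv_sub_mul hn hdeg hmom hmass hm,
      (hasDerivAt_assocDensity hV hn hdeg ε m x).deriv]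
    field_simp
  have hd := hu'.differentiable (by simp)
  refine ⟨hfix, ⟨fun x => div_nonneg (Real.exp_pos _).le hpos.le, hmom, hmass,
    contDiff_infty.1 hu 2, ?_, fun x => ?_⟩, hm⟩
  · rw [hflux]
    exact hd.const_mul _
  · rw [hflux, iteratedDeriv_succ, iteratedDeriv_one, ((hd x).hasDerivAt.const_mul _).deriv]
    ring

end Stationary

/-! ### Symmetry under x ↦ -x. -/

section Reflection

/-- The moment vector of the reflected density. -/
def reflect (m : Fin (2 * n - 1) → ℝ) : Fin (2 * n - 1) → ℝ := fun i => (-1) ^ ((i : ℕ) + 1) * m i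

/-- The form of Z_m freed from the centre a makes parity visible: the p-th derivative of F and the
p-th moment both acquire the sign (-1)^p. -/
theorem weight_reflect (hV : IsDoubleWell V a q C) (hF : IsInteraction F q C) (hn : 1 ≤ n)
    (hdeg : F.natDegree = 2 * n) (ε : ℝ) (m : Fin (2 * n - 1) → ℝ) (x : ℝ) :
    weight V F a n ε (reflect m) x = weight V F a n ε m (-x) := by
  have hsum : ∑ i : Fin (2 * n - 1), interactionCoeff i * reflect m i * polyDeriv F (i + 1) x =
      ∑ i : Fin (2 * n - 1), interactionCoeff i * m i *
        ((-1) ^ ((i : ℕ) + 1) * polyDeriv F (i + 1) x) :=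
    Finset.sum_congr rfl fun i _ => by rw [reflect]; ring
  rw [weight, weight, Z_eq hn hdeg, Z_eq hn hdeg, hV.even, hsum]
  simp only [polyDeriv_neg hF.even, pow_zero, one_mul, (even_two_mul n).neg_one_pow]

theorem integrable_reflect (hV : IsDoubleWell V a q C) (hF : IsInteraction F q C) (hn : 1 ≤ n)
    (hdeg : F.natDegree = 2 * n) {ε : ℝ} {m : Fin (2 * n - 1) → ℝ} {k : ℕ}
    (hint : Integrable (fun x => x ^ k * weight V F a n ε m x)) :
    Integrable (fun x => x ^ k * weight V F a n ε (reflect m) x) := by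
  have h := hint.comp_neg.const_mul ((-1) ^ k)
  refine h.congr (Eventually.of_forall fun x => ?_)
  simp only [weight_reflect hV hF hn hdeg, neg_pow x]
  rw [← mul_assoc, ← mul_assoc, ← mul_pow]
  norm_num

theorem momentMap_reflect (hV : IsDoubleWell V a q C) (hF : IsInteraction F q C) (hn : 1 ≤ n)
    (hdeg : F.natDegree = 2 * n) (ε : ℝ) (m : Fin (2 * n - 1) → ℝ) :
    momentMap V F a n ε (reflect m) = reflect (momentMap V F a n ε m) := by
  have key : ∀ k : ℕ, ∫ x, x ^ k * weight V F a n ε (reflect m) x =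
      (-1) ^ k * ∫ x, x ^ k * weight V F a n ε m x := by
    intro k
    rw [← integral_neg_eq_self (fun x => x ^ k * weight V F a n ε (reflect m) x),
      ← integral_const_mul]
    congr 1
    funext x
    rw [weight_reflect hV hF hn hdeg, neg_neg, neg_pow x]
    ring
  have h0 := key 0
  simp only [pow_zero, one_mul] at h0
  funext i
  simp only [momentMap, reflect, key, h0]
  rw [mul_div_assoc]

end Reflection

/-! ### Rescaling around (a^k) and existence of the fixed points. -/

theorem exists_weight_eq (hC : 0 < C) (hV : IsDoubleWell V a q C) (hF : IsInteraction F q C)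
    (hn : 1 ≤ n) (hdeg : F.natDegree = 2 * n) (hw : 0 < alpha F + iteratedDeriv 2 V a)
    {r : ℝ} (hr : 0 < r) (s : Fin (2 * n - 1) → ℝ) :
    ∃ κ > 0, ∀ x, weight V F a n (r ^ 2) (fun i => a ^ ((i : ℕ) + 1) + r ^ 2 * s i) x =
      κ * (laplaceFamily hC hV hF hn hdeg hw).density r s x := by
  refine ⟨Real.exp (-(2 / r ^ 2) * (V a + polyDeriv F 0 0) -
    2 * ∑ i : Fin (2 * n - 1), s i * (interactionCoeff i * polyDeriv F (i + 1) a)),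
    Real.exp_pos _, fun x => ?_⟩
  have h1 : ∑ i : Fin (2 * n - 1),
      (-1) ^ ((i : ℕ) + 1) / (((i : ℕ) + 1).factorial : ℝ) *
        (a ^ ((i : ℕ) + 1) + r ^ 2 * s i - a ^ ((i : ℕ) + 1)) * polyDeriv F ((i : ℕ) + 1) x =
      r ^ 2 * (∑ i : Fin (2 * n - 1), s i * (interactionCoeff i *
        (polyDeriv F (i + 1) x - polyDeriv F (i + 1) a)) +
        ∑ i : Fin (2 * n - 1), s i * (interactionCoeff i * polyDeriv F (i + 1) a)) := by
    rw [← Finset.sum_add_distrib, Finset.mul_sum]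
    exact Finset.sum_congr rfl fun i _ => by rw [interactionCoeff]; ring
  rw [weight, Z, h1, LaplaceFamily.density, ← Real.exp_add]
  congr 1
  simp only [laplaceFamily, phase, polyDeriv_zero]
  field_simp
  ring

theorem momentMap_eq_mean (hC : 0 < C) (hV : IsDoubleWell V a q C) (hF : IsInteraction F q C)
    (hn : 1 ≤ n) (hdeg : F.natDegree = 2 * n) (hw : 0 < alpha F + iteratedDeriv 2 V a)
    {r : ℝ} (hr : 0 < r) (s : Fin (2 * n - 1) → ℝ) (i : Fin (2 * n - 1)) :
    momentMap V F a n (r ^ 2) (fun i => a ^ ((i : ℕ) + 1) + r ^ 2 * s i) i =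
      (laplaceFamily hC hV hF hn hdeg hw).mean r s (fun x => x ^ ((i : ℕ) + 1)) := by
  obtain ⟨κ, hκ, hweight⟩ := exists_weight_eq hC hV hF hn hdeg hw hr s
  simp only [momentMap, hweight, LaplaceFamily.mean, mul_left_comm _ κ, integral_const_mul]
  rw [mul_div_mul_left _ _ hκ.ne']

theorem exists_invariantFixedPoint (hC : 0 < C) (hV : IsDoubleWell V a q C)
    (hF : IsInteraction F q C) (hn : 1 ≤ n) (hdeg : F.natDegree = 2 * n)
    (hcond : ∑ p ∈ Finset.range (2 * n - 1), |polyDeriv F (p + 2) a| / (p.factorial : ℝ) * a ^ p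
      < alpha F + iteratedDeriv 2 V a) {δ : ℝ} (hδ : 0 < δ) :
    ∃ ε₀ : ℝ, 0 < ε₀ ∧ ∀ ε : ℝ, 0 < ε → ε ≤ ε₀ → ∃ m : Fin (2 * n - 1) → ℝ,
      IsInvariantFixedPoint V F a n ε m ∧ IsInvariantFixedPoint V F a n ε (reflect m) ∧
      ∀ i : Fin (2 * n - 1), |m i - (a ^ ((i : ℕ) + 1) - tau V F a n i * ε)| ≤ δ * ε := by
  have ha := hV.a_pos
  have hw : 0 < alpha F + iteratedDeriv 2 V a :=
    lt_of_le_of_lt (Finset.sum_nonneg fun p _ => by positivity) hcond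
  set w := alpha F + iteratedDeriv 2 V a with hwdef
  let L := laplaceFamily hC hV hF hn hdeg hw
  obtain ⟨B, hB⟩ := L.exists_selfConsistent (f := fun i x => x ^ ((i : ℕ) + 1))
    (b := fun i => ((i : ℝ) + 1) * a ^ (i : ℕ)) (s₀ := fun i => -tau V F a n i) (δ := δ)
    (fun i => contDiff_id.pow _) (fun i => PolyO.id_pow _ _) (fun i => by positivity)
    -- The products |γ_i| b_i are exactly the terms |F^(i+2)(a)| a^i / i! of the hypothesis.
    (fun i => by simp [L, laplaceFamily]) (by
      refine lt_of_eq_of_lt ?_ hcond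
      rw [Finset.sum_range]
      refine Finset.sum_congr rfl fun i _ => ?_
      have hb : 0 < ((i : ℝ) + 1) * a ^ (i : ℕ) := by positivity
      have h := congrArg abs (interactionCoeff_mul i a)
      rw [abs_mul, abs_of_pos hb, abs_neg, abs_div, abs_pow, abs_neg, abs_of_pos ha,
        abs_of_pos (by positivity : (0 : ℝ) < ((i : ℕ).factorial : ℝ))] at h
      simp only [L, laplaceFamily]
      rw [abs_mul, mul_right_comm, h]
      ring)
    (fun i => by
      have h := isCramerSolution_tau hV hF hn hdeg hw i
      have hsum : ∑ j : Fin (2 * n - 1), -tau V F a n j * L.γ j =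
          -∑ p : Fin (2 * n - 1), (-1) ^ ((p : ℕ) + 1) / (((p : ℕ) + 1).factorial : ℝ)
            * polyDeriv F ((p : ℕ) + 2) a * tau V F a n p := by
        rw [← Finset.sum_neg_distrib]
        refine Finset.sum_congr rfl fun j _ => ?_
        simp only [L, laplaceFamily, interactionCoeff]
        ring
      have hderiv : iteratedDeriv 2 (fun x : ℝ => x ^ ((i : ℕ) + 1)) a =
          ((i : ℝ) + 1) * a ^ (i : ℕ) * (i / a) := by
        rw [iteratedDeriv_pow]
        rcases Nat.eq_zero_or_pos (i : ℕ) with h0 | h0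
        · simp [h0]
        · obtain ⟨k, hk⟩ := Nat.exists_eq_succ_of_ne_zero h0.ne'
          rw [hk]
          simp [Nat.descFactorial_succ, pow_succ]
          field_simp
      rw [hsum]
      -- The limiting self-consistency equation at s₀ = -τ⁰ is the linear system multiplied by k
      -- a^(k-1) / w.
      change -tau V F a n i = -(((i : ℝ) + 1) * a ^ (i : ℕ)) * (_ / w +
        iteratedDeriv 3 V a / 2 / (2 * w ^ 2)) +
        iteratedDeriv 2 (fun x : ℝ => x ^ ((i : ℕ) + 1)) a / (4 * w)
      rw [hderiv]
      rw [← hwdef] at h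
      have hai : a ^ (i : ℕ) ≠ 0 := by positivity
      have hi : (i : ℝ) + 1 ≠ 0 := by positivity
      generalize (∑ p : Fin (2 * n - 1), (-1) ^ ((p : ℕ) + 1) / (((p : ℕ) + 1).factorial : ℝ)
            * polyDeriv F ((p : ℕ) + 2) a * tau V F a n p) = S at h ⊢
      generalize a ^ (i : ℕ) = A at h hai ⊢
      have h' : tau V F a n i = (((i : ℝ) + 1) * A) / w * (iteratedDeriv 3 V a / (4 * w) -
          ((i : ℕ) : ℝ) / (4 * a) - S) := by
        rw [← h]; field_simp; ring
      rw [h']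
      field_simp
      ring) hδ
  obtain ⟨r₀, hr₀, hr⟩ := mem_nhdsGT_iff_exists_Ioc_subset.1 hB
  have hr₀ : 0 < r₀ := hr₀
  refine ⟨r₀ ^ 2, by positivity, fun ε hε hε₀ => ?_⟩
  have hsq : Real.sqrt ε ^ 2 = ε := Real.sq_sqrt hε.le
  have hrpos : 0 < Real.sqrt ε := Real.sqrt_pos.2 hε
  obtain ⟨s, hclose, hdom, hmean⟩ := hr (a := Real.sqrt ε)
    ⟨hrpos, Real.sqrt_le_iff.2 ⟨hr₀.le, hε₀⟩⟩
  set m : Fin (2 * n - 1) → ℝ := fun i => a ^ ((i : ℕ) + 1) + Real.sqrt ε ^ 2 * s i with hm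
  have hfix : momentMap V F a n ε m = m := by
    funext i
    have h1 := momentMap_eq_mean hC hV hF hn hdeg hw hrpos s i
    have h2 := hmean i
    rw [h2, ← hm, hsq] at h1
    rw [h1]
    simp only [hm, hsq]
    rfl
  have hint : ∀ k : ℕ, Integrable (fun x => x ^ k * weight V F a n ε m x) := by
    intro k
    obtain ⟨κ, -, hweight⟩ := exists_weight_eq hC hV hF hn hdeg hw hrpos s
    rw [hsq] at hweight
    rw [hm, hsq]
    simp only [hweight, mul_left_comm _ κ]
    exact (hdom.integrable (PolyO.id_pow _ k)).const_mul κ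
  refine ⟨m, isInvariantFixedPoint_of_fixed hV hn hdeg hε hint hfix,
    isInvariantFixedPoint_of_fixed hV hn hdeg hε
      (fun k => integrable_reflect hV hF hn hdeg (hint k))
      (by rw [momentMap_reflect hV hF hn hdeg, hfix]), fun i => ?_⟩
  have h1 := hclose i
  have : m i - (a ^ ((i : ℕ) + 1) - tau V F a n i * ε) = ε * (s i - -tau V F a n i) := by
    simp only [hm, hsq]; ring
  rw [this, abs_mul, abs_of_pos hε, mul_comm]
  gcongr

end SelfStab

end

theorem theorem4p10 (V : ℝ → ℝ) (F : Polynomial ℝ) (a : ℝ) (q : ℕ) (C : ℝ) (n : ℕ)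
    (hq : 1 ≤ q) (hC : 0 < C)
    (hV : SelfStab.IsDoubleWell V a q C) (hF : SelfStab.IsInteraction F q C)
    (hn : 1 ≤ n) (hdeg : F.natDegree = 2 * n)
    (hcond : ∑ p ∈ Finset.range (2 * n - 1),
        |SelfStab.polyDeriv F (p + 2) a| / (p.factorial : ℝ) * a ^ p
      < SelfStab.alpha F + iteratedDeriv 2 V a) :
    SelfStab.IsCramerSolution V F a n (SelfStab.tau V F a n) ∧
    (∀ τ, SelfStab.IsCramerSolution V F a n τ → τ = SelfStab.tau V F a n) ∧
    ∀ δ : ℝ, 0 < δ → ∃ ε₀ : ℝ, 0 < ε₀ ∧ ∀ ε : ℝ, 0 < ε → ε ≤ ε₀ →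
      ∃ mp mm : Fin (2 * n - 1) → ℝ, mp ≠ mm ∧
        SelfStab.IsInvariantFixedPoint V F a n ε mp ∧
        SelfStab.IsInvariantFixedPoint V F a n ε mm ∧
        (∀ i : Fin (2 * n - 1),
          |mp i - (a ^ ((i : ℕ) + 1) - SelfStab.tau V F a n i * ε)|
              ≤ δ * (((i : ℕ) + 1 : ℝ) * a ^ (i : ℕ)) * ε ∧
          (SelfStab.tau V F a n i ≠ 0 →
            |mp i - (a ^ ((i : ℕ) + 1) - SelfStab.tau V F a n i * ε)|
              ≤ δ * |SelfStab.tau V F a n i| * ε)) ∧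
        (∀ i : Fin (2 * n - 1),
          |mm i - ((-1) ^ ((i : ℕ) + 1) * a ^ ((i : ℕ) + 1)
                - (-1) ^ ((i : ℕ) + 1) * SelfStab.tau V F a n i * ε)|
              ≤ δ * (((i : ℕ) + 1 : ℝ) * a ^ (i : ℕ)) * ε ∧
          (SelfStab.tau V F a n i ≠ 0 →
            |mm i - ((-1) ^ ((i : ℕ) + 1) * a ^ ((i : ℕ) + 1)
                - (-1) ^ ((i : ℕ) + 1) * SelfStab.tau V F a n i * ε)|
              ≤ δ * |SelfStab.tau V F a n i| * ε)) := by
  have ha := hV.a_pos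
  have hw : 0 < SelfStab.alpha F + iteratedDeriv 2 V a :=
    lt_of_le_of_lt (Finset.sum_nonneg fun p _ => by positivity) hcond
  have hτ := SelfStab.isCramerSolution_tau hV hF hn hdeg hw
  refine ⟨hτ, fun τ h => h.eq hV hn hdeg hw hτ, fun δ hδ => ?_⟩
  let i₀ : Fin (2 * n - 1) := ⟨0, by omega⟩
  have : Nonempty (Fin (2 * n - 1)) := ⟨i₀⟩
  set t := SelfStab.tau V F a n with ht
  -- Absolute tolerance implying both requested bounds at index i; the value 1 is a harmless default
  -- where the second bound is not required. The smallest η over the finite index set serves all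
  -- indices.
  let η : Fin (2 * n - 1) → ℝ := fun i =>
    δ * min (((i : ℕ) + 1 : ℝ) * a ^ (i : ℕ)) (if t i = 0 then 1 else |t i|)
  have hη : ∀ i, 0 < η i := fun i => by
    refine mul_pos hδ (lt_min (by positivity) ?_)
    split_ifs with h
    · exact one_pos
    · exact abs_pos.2 h
  obtain ⟨j, hj⟩ := Finite.exists_min η
  obtain ⟨ε₀, hε₀, hex⟩ := SelfStab.exists_invariantFixedPoint hC hV hF hn hdeg hcond (hη j)
  have hden : 0 < |t i₀| + η j + 1 := by have := hη j; positivity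
  -- The second bound on ε keeps the first moment of m positive, so m differs from its reflection,
  -- whose first moment is negative.
  refine ⟨min ε₀ (a / (|t i₀| + η j + 1)), lt_min hε₀ (by positivity), fun ε hε hεle => ?_⟩
  obtain ⟨m, hm, hm', hbound⟩ := hex ε hε (hεle.trans (min_le_left _ _))
  have hε2 : ε * (|t i₀| + η j + 1) ≤ a := by
    have := hεle.trans (min_le_right _ _)
    rwa [le_div_iff₀ hden] at this
  have hb1 : ∀ i, |m i - (a ^ ((i : ℕ) + 1) - t i * ε)|
      ≤ δ * (((i : ℕ) + 1 : ℝ) * a ^ (i : ℕ)) * ε := fun i => by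
    refine (hbound i).trans ?_
    gcongr
    refine (hj i).trans ?_
    simp only [η]
    gcongr
    exact min_le_left _ _
  have hb2 : ∀ i, t i ≠ 0 → |m i - (a ^ ((i : ℕ) + 1) - t i * ε)| ≤ δ * |t i| * ε :=
    fun i hi => by
    refine (hbound i).trans ?_
    gcongr
    refine (hj i).trans ?_
    simp only [η, if_neg hi]
    gcongr
    exact min_le_right _ _
  have hrefl : ∀ i : Fin (2 * n - 1), |SelfStab.reflect m i - ((-1) ^ ((i : ℕ) + 1) * a ^ ((i : ℕ) + 1)
      - (-1) ^ ((i : ℕ) + 1) * t i * ε)| = |m i - (a ^ ((i : ℕ) + 1) - t i * ε)| := fun i => by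
    have : SelfStab.reflect m i - ((-1) ^ ((i : ℕ) + 1) * a ^ ((i : ℕ) + 1)
      - (-1) ^ ((i : ℕ) + 1) * t i * ε) =
      (-1) ^ ((i : ℕ) + 1) * (m i - (a ^ ((i : ℕ) + 1) - t i * ε)) := by
      rw [SelfStab.reflect]; ring
    rw [this, abs_mul, abs_neg_one_pow, one_mul]
  refine ⟨m, SelfStab.reflect m, fun heq => ?_, hm, hm', fun i => ⟨hb1 i, hb2 i⟩, fun i => ?_⟩
  · have h0 := congrFun heq i₀
    have hpos : 0 < m i₀ := by
      have h1 := (abs_le.1 (hbound i₀)).1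
      have h2 : t i₀ * ε ≤ |t i₀| * ε := by gcongr; exact le_abs_self _
      have h3 : a ^ ((i₀ : ℕ) + 1) = a := by simp [i₀]
      rw [h3] at h1
      nlinarith
    have h4 : SelfStab.reflect m i₀ = -m i₀ := by simp [SelfStab.reflect, i₀]
    linarith
  · rw [hrefl i]
    exact ⟨hb1 i, hb2 i⟩
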